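/- Graphs are finite and undirected and may have parallel edges but no loops. A diamond is any subdivision of the graph consisting of two vertices joined by three parallel edges; equivalently, it is the union of three paths with the same two distinct ends that are pairwise edge-disjoint and pairwise share no vertex other than these ends. For a graph $G$, let $\mathcal{D}(G)$ be the set of all subgraphs of $G$ that are diamonds. For vertex costs $c_v \ge 0$ ($v \in V(G)$), let $\mathrm{LP}(G,c)$ be the optimum value of the linear program $$\min \sum_{v \in V(G)} c_v x_v \quad\text{subject to}\quad \sum_{v \in V(D)} x_v \ge 1 \ \ (D \in \mathcal{D}(G)), \qquad x_v \ge 0 \ \ (v \in V(G)),$$ and let $\mathrm{OPT}(G,c)$ be the optimum value of the corresponding integer program, in which moreover $x_v \in \{0,1\}$ for all $v \in V(G)$; that is, $\mathrm{OPT}(G,c)$ is the minimum cost of a set of vertices meeting every diamond of $G$. For $n \in \mathbb{N}$, let the integrality gap $\mathrm{gap}(n) \in [0,\infty]$ be the supremum of the ratio $\mathrm{OPT}(G,c)/\mathrm{LP}(G,c)$ over all graphs $G$ with exactly $n$ vertices and all nonnegative vertex costs $c$ on $G$ (with the conventions $0/0 = 0$ and $a/0 = \infty$ for $a > 0$). Proposition.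 The integrality gap of the linear program given by nonnegativity and diamond inequalities is $\Theta(\log n)$: $\mathrm{gap}(n)$ is finite for every $n$, and there are constants $0 < a \le b$ and $n_0 \in \mathbb{N}$ such that $a \log n \le \mathrm{gap}(n) \le b \log n$ for all $n \ge n_0$. -/

import Mathlib

open scoped ENNReal

namespace Graph

/-- The multigraph `P` is a path with ends `u` and `v`: its vertices are distinct vertices
`x 0 = u, x 1, …, x n = v`, and its edges are `e 0, …, e (n - 1)`, where `e i` joins `x i` and
`x (i + 1)`. -/
def IsPathBetween {α β : Type*} (P : Graph α β) (u v : α) : Prop :=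
  ∃ (n : ℕ) (x : Fin (n + 1) → α) (e : Fin n → β),
    Function.Injective x ∧ x 0 = u ∧ x (Fin.last n) = v ∧
    V(P) = Set.range x ∧ E(P) = Set.range e ∧
    ∀ i : Fin n, P.IsLink (e i) (x i.castSucc) (x i.succ)

/-- A diamond is a subdivision of the graph consisting of three parallel edges: the union of
three paths having the same two distinct ends, pairwise edge-disjoint and with pairwise no common
vertex other than these ends. -/
def IsDiamond {α β : Type*} (D : Graph α β) : Prop :=
  ∃ (u v : α) (P : Fin 3 → Graph α β), u ≠ v ∧
    (∀ i, P i ≤ D ∧ (P i).IsPathBetween u v) ∧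
    (∀ i j, i ≠ j → V(P i) ∩ V(P j) = {u, v} ∧ Disjoint E(P i) E(P j)) ∧
    V(D) = ⋃ i, V(P i) ∧ E(D) = ⋃ i, E(P i)

/-- The feasible region of the linear program given by nonnegativity and diamond inequalities
(only the values of `x` on `V(G)` matter). -/
def diamondLPRegion {α β : Type*} (G : Graph α β) : Set (α → ℝ) :=
  {x | (∀ v ∈ V(G), 0 ≤ x v) ∧
    ∀ D : Graph α β, D ≤ G → D.IsDiamond → 1 ≤ ∑ᶠ v ∈ V(D), x v}

/-- The feasible region of the integer program: the 0/1 points of the linear program, that is,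
the incidence vectors of the diamond hitting sets of `G`. -/
def diamondIPRegion {α β : Type*} (G : Graph α β) : Set (α → ℝ) :=
  {x | x ∈ G.diamondLPRegion ∧ ∀ v ∈ V(G), x v = 0 ∨ x v = 1}

/-- The optimum value of the linear program with nonnegative vertex costs `c`. -/
noncomputable def diamondLPValue {α β : Type*} (G : Graph α β) (c : α → ℝ) : ℝ≥0∞ :=
  ⨅ x ∈ G.diamondLPRegion, ENNReal.ofReal (∑ᶠ v ∈ V(G), c v * x v)

/-- The optimum value of the integer program with nonnegative vertex costs `c`, that is, the
minimum cost of a diamond hitting set. -/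
noncomputable def diamondIPValue {α β : Type*} (G : Graph α β) (c : α → ℝ) : ℝ≥0∞ :=
  ⨅ x ∈ G.diamondIPRegion, ENNReal.ofReal (∑ᶠ v ∈ V(G), c v * x v)

/-- The integrality gap on `n`-vertex instances: the supremum, over all finite loopless multigraphs
`G` with exactly `n` vertices and all nonnegative vertex costs `c`, of the ratio of the integer
optimum to the linear optimum. In `ℝ≥0∞` one has `a / 0 = ∞` for `a ≠ 0` and `0 / 0 = 0`, so that
only instances whose two optima are both zero are disregarded. -/
noncomputable def diamondIntegralityGap (n : ℕ) : ℝ≥0∞ :=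
  sSup {r | ∃ (α β : Type) (G : Graph α β) (c : α → ℝ),
    V(G).encard = n ∧ E(G).Finite ∧ G.Loopless ∧ (∀ v ∈ V(G), 0 ≤ c v) ∧
    r = G.diamondIPValue c / G.diamondLPValue c}

end Graph

/-! Upper bound. Any fractional solution `x` can be rounded to a hitting set at a loss of `O(log
n)`. Scale `x` to integer vertex weights. Region growing (`exists_cheap_separator`) deletes a vertex
set costing `O(log n)` times the fractional cost, so that any two vertices still connected are
joined by a walk of weight at most a tenth of the scale. If a diamond survived, there would be a
light one (`IsDiamond.exists_light`). To see this, divide the vertices into the two Voronoi cells of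
the ends `u`, `v` of the diamond. Its three paths pass from one cell to the other along three
distinct edges, and shortest walks inside the cells join the ends of these edges to `u` and `v`.
These six light walks and three edges contain a diamond, by `exists_isDiamond_of_cut`. Its `x`-value
is below 1, which contradicts feasibility. The combinatorial core is `exists_isDiamond_of_edgeConn`:
edge-disjointness alone suffices for a diamond.

Lower bound. Take a graph that is edge-maximal subject to having maximum degree at most 16 and only
diamonds with at least `g` vertices, where `g` is of order `log n`. By maximality almost all degrees
equal 16 (`exists_simpleGraph_large_diamonds`). With unit costs the constant vector `1 / g` is
feasible, so the linear optimum is at most `n / g`. Diamond-free graphs are sparse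
(`sum_card_nbrs_inter_le`), so a hitting set must contain at least `n / 7` vertices. -/

namespace Graph

/-! ### Edge connections, paths, and how they yield diamonds -/

section Paths

variable {α β : Type*} {G : Graph α β}

/-- The vertices `u` and `v` are connected by edges of `G` belonging to `F`. -/
def EdgeConn (G : Graph α β) (F : Finset β) (u v : α) : Prop :=
  Relation.ReflTransGen (fun a b => ∃ e ∈ F, G.IsLink e a b) u v

namespace EdgeConn

variable {F F' : Finset β} {u v w : α}

theorem rfl : G.EdgeConn F u u := Relation.ReflTransGen.refl

theorem mono (h : G.EdgeConn F u v) (hF : F ⊆ F') : G.EdgeConn F' u v :=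
  Relation.ReflTransGen.mono (fun _ _ ⟨e, he, hl⟩ => ⟨e, hF he, hl⟩) _ _ h

theorem symm (h : G.EdgeConn F u v) : G.EdgeConn F v u :=
  have : Std.Symm (fun a b => ∃ e ∈ F, G.IsLink e a b) :=
    ⟨fun _ _ ⟨e, he, hl⟩ => ⟨e, he, hl.symm⟩⟩
  Relation.ReflTransGen.stdSymm.symm _ _ h

theorem trans (h : G.EdgeConn F u v) (h' : G.EdgeConn F v w) : G.EdgeConn F u w :=
  Relation.ReflTransGen.trans h h'

theorem of_isLink {e : β} (he : e ∈ F) (h : G.IsLink e u v) : G.EdgeConn F u v :=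
  Relation.ReflTransGen.single ⟨e, he, h⟩

theorem left_mem (h : G.EdgeConn F u v) (huv : u ≠ v) : u ∈ V(G) := by
  rcases Relation.ReflTransGen.cases_head h with h | ⟨w, ⟨e, -, hl⟩, -⟩
  · exact absurd h huv
  · exact hl.left_mem

theorem nonempty (h : G.EdgeConn F u v) (huv : u ≠ v) : F.Nonempty := by
  rcases Relation.ReflTransGen.cases_head h with h | ⟨w, ⟨e, he, -⟩, -⟩
  · exact absurd h huv
  · exact ⟨e, he⟩

theorem of_le {H : Graph α β} (h : H.EdgeConn F u v) (hle : H ≤ G) : G.EdgeConn F u v :=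
  Relation.ReflTransGen.mono (fun _ _ ⟨e, he, hl⟩ => ⟨e, he, hl.mono hle⟩) _ _ h

/-- A connection leaving a vertex set uses an edge leaving this set. -/
theorem exists_isLink_of_mem_of_notMem (h : G.EdgeConn F u v) {A : Set α} (hu : u ∈ A)
    (hv : v ∉ A) : ∃ e ∈ F, ∃ a ∈ A, ∃ b ∉ A, G.IsLink e a b ∧ G.EdgeConn F u b := by
  induction h with
  | refl => exact absurd hu hv
  | @tail b c hb hbc ih =>
    by_cases hbA : b ∈ A
    · obtain ⟨e, he, hl⟩ := hbc
      exact ⟨e, he, b, hbA, c, hv, hl, Relation.ReflTransGen.tail hb ⟨e, he, hl⟩⟩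
    · exact ih hbA

end EdgeConn

theorem induce_restrict_mono {W W' : Finset α} {F F' : Finset β} (hW : W ⊆ W')
    (hF : F ⊆ F') : (G.restrict F).induce W ≤ (G.restrict F').induce W' where
  vertexSet_mono := by simpa using hW
  isLink_mono := by
    intro e x y h
    simp only [induce_isLink, restrict_isLink] at h ⊢
    exact ⟨⟨hF h.1.1, h.1.2⟩, hW h.2.1, hW h.2.2⟩

theorem edgeSet_induce_restrict_subset {W : Finset α} {F : Finset β} :
    E((G.restrict F).induce W) ⊆ F := by
  intro e he
  obtain ⟨a, b, h⟩ := exists_isLink_of_mem_edgeSet he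
  simp only [induce_isLink, restrict_isLink] at h
  exact h.1.1

theorem EdgeConn.mem_of_mem {F : Finset β} {S : Set α} {a b : α} (h : G.EdgeConn F a b)
    (hF : ∀ e ∈ F, ∀ x y, G.IsLink e x y → x ∈ S) (ha : a ∈ S) : b ∈ S := by
  rcases Relation.ReflTransGen.cases_tail h with h | ⟨w, -, e, he, hl⟩
  · exact h ▸ ha
  · exact hF e he _ _ hl.symm

variable [DecidableEq α] [DecidableEq β]

/-- There is a path of `G` from `u` to `v` with vertex set `W` and edge set `F`. -/
inductive PathOn (G : Graph α β) : α → α → Finset α → Finset β → Prop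
  | nil {u : α} (hu : u ∈ V(G)) : PathOn G u u {u} ∅
  | cons {e : β} {u w v : α} {W : Finset α} {F : Finset β} (h : G.IsLink e u w)
      (hP : PathOn G w v W F) (hu : u ∉ W) : PathOn G u v (insert u W) (insert e F)

namespace PathOn

variable {u v m : α} {W : Finset α} {F : Finset β}

theorem left_mem (h : G.PathOn u v W F) : u ∈ W := by
  cases h <;> simp

theorem right_mem (h : G.PathOn u v W F) : v ∈ W := by
  induction h with
  | nil => simp
  | cons _ _ _ ih => exact Finset.mem_insert_of_mem ih

theorem mem_vertexSet (h : G.PathOn u v W F) {a : α} (ha : a ∈ W) : a ∈ V(G) := by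
  induction h with
  | nil hu => rw [Finset.mem_singleton] at ha; exact ha ▸ hu
  | cons hl _ _ ih =>
    rcases Finset.mem_insert.1 ha with rfl | ha
    · exact hl.left_mem
    · exact ih ha

theorem exists_isLink (h : G.PathOn u v W F) {e : β} (he : e ∈ F) :
    ∃ a ∈ W, ∃ b ∈ W, G.IsLink e a b := by
  induction h with
  | nil hu => simp at he
  | cons hl hP _ ih =>
    rcases Finset.mem_insert.1 he with rfl | he
    · exact ⟨_, by simp, _, Finset.mem_insert_of_mem hP.left_mem, hl⟩
    · obtain ⟨a, ha, b, hb, hab⟩ := ih he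
      exact ⟨a, Finset.mem_insert_of_mem ha, b, Finset.mem_insert_of_mem hb, hab⟩

theorem mem_of_isLink (h : G.PathOn u v W F) {e : β} (he : e ∈ F) {a b : α}
    (hl : G.IsLink e a b) : a ∈ W := by
  obtain ⟨x, hx, y, hy, hxy⟩ := h.exists_isLink he
  rcases hl.left_eq_or_eq hxy with rfl | rfl <;> assumption

theorem edgeConn (h : G.PathOn u v W F) : G.EdgeConn F u v := by
  induction h with
  | nil => exact EdgeConn.rfl
  | cons hl _ _ ih =>
    exact (EdgeConn.of_isLink (Finset.mem_insert_self _ _) hl).trans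
      (ih.mono (Finset.subset_insert _ _))

theorem split (h : G.PathOn u v W F) (hm : m ∈ W) : ∃ W₁ W₂ F₁ F₂, G.PathOn u m W₁ F₁ ∧
    G.PathOn m v W₂ F₂ ∧ W₁ ∪ W₂ = W ∧ F₁ ∪ F₂ = F ∧ Disjoint F₁ F₂ := by
  induction h with
  | @nil u hu =>
    obtain rfl := Finset.mem_singleton.1 hm
    exact ⟨_, _, _, _, .nil hu, .nil hu, by simp, by simp, by simp⟩
  | @cons e u w v W F hl hP hu ih =>
    rcases Finset.mem_insert.1 hm with rfl | hm
    · exact ⟨_, _, _, _, .nil hl.left_mem, .cons hl hP hu, by simp, by simp, by simp⟩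
    · obtain ⟨W₁, W₂, F₁, F₂, h₁, h₂, rfl, rfl, hF⟩ := ih hm
      rw [Finset.mem_union, not_or] at hu
      refine ⟨_, _, _, _, .cons hl h₁ hu.1, h₂, by simp, by simp, ?_⟩
      rw [Finset.disjoint_insert_left]
      exact ⟨fun he => hu.2 (h₂.mem_of_isLink he hl), hF⟩

/-- Loop erasure: if the vertex to be prepended already lies on the path, only the part of the path
from that vertex on is kept. -/
theorem exists_of_edgeConn (h : G.EdgeConn F u v) (hv : v ∈ V(G)) :
    ∃ W, ∃ F' ⊆ F, G.PathOn u v W F' := by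
  induction h using Relation.ReflTransGen.head_induction_on with
  | refl => exact ⟨_, _, by simp, .nil hv⟩
  | @head a b hab _ ih =>
    obtain ⟨e, he, hl⟩ := hab
    obtain ⟨W, F', hF', hP⟩ := ih
    by_cases ha : a ∈ W
    · obtain ⟨_, W₂, F₁, F₂, -, h₂, -, rfl, -⟩ := hP.split ha
      exact ⟨W₂, F₂, Finset.union_subset_right hF', h₂⟩
    · exact ⟨_, _, Finset.insert_subset he hF', .cons hl hP ha⟩

theorem exists_fin (h : G.PathOn u v W F) : ∃ (n : ℕ) (x : Fin (n + 1) → α) (e : Fin n → β),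
    Function.Injective x ∧ x 0 = u ∧ x (Fin.last n) = v ∧ (W : Set α) = Set.range x ∧
      (F : Set β) = Set.range e ∧ ∀ i : Fin n, G.IsLink (e i) (x i.castSucc) (x i.succ) := by
  induction h with
  | @nil u hu =>
    refine ⟨0, fun _ => u, Fin.elim0, fun a b _ => Subsingleton.elim (α := Fin 1) a b, rfl, rfl,
      ?_, ?_, fun i => i.elim0⟩
    · ext; simp [eq_comm]
    · ext; simp
  | @cons e u w v W F hl hP hu ih =>
    obtain ⟨n, x, f, hx, h0, hlast, hW, hF, hlink⟩ := ih
    refine ⟨n + 1, Fin.cons u x, Fin.cons e f, ?_, rfl, ?_, ?_, ?_, ?_⟩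
    · refine Fin.cons_injective_iff.2 ⟨?_, hx⟩
      rwa [← hW]
    · rw [← Fin.succ_last, Fin.cons_succ, hlast]
    · rw [Fin.range_cons, ← hW, Finset.coe_insert]
    · rw [Fin.range_cons, ← hF, Finset.coe_insert]
    · intro i
      refine Fin.cases ?_ (fun j => ?_) i
      · simpa [h0] using hl
      · simpa using hlink j

theorem isPathBetween (h : G.PathOn u v W F) {P : Graph α β} (hV : V(P) = W) (hE : E(P) = F)
    (hP : P ≤ G) : P.IsPathBetween u v := by
  obtain ⟨n, x, e, hx, h0, hl, hW, hF, hlink⟩ := h.exists_fin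
  refine ⟨n, x, e, hx, h0, hl, hV.trans hW, hE.trans hF, fun i => ?_⟩
  rw [hP.isLink_iff]
  · exact hlink i
  · rw [hE, hF]
    exact ⟨i, rfl⟩

theorem edgeSet_induce_restrict (h : G.PathOn u v W F) {F' : Finset β} (hF : F ⊆ F')
    {W' : Finset α} (hW : W ⊆ W') : (F : Set β) ⊆ E((G.restrict F').induce W') := by
  intro e he
  obtain ⟨a, ha, b, hb, hl⟩ := h.exists_isLink he
  have : ((G.restrict F').induce W').IsLink e a b := by
    simp only [induce_isLink, restrict_isLink]
    exact ⟨⟨hF he, hl⟩, hW ha, hW hb⟩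
  exact this.edge_mem

end PathOn

theorem exists_isDiamond_of_pathOn {u v : α} (huv : u ≠ v) (W : Fin 3 → Finset α)
    (F : Fin 3 → Finset β) (hP : ∀ i, G.PathOn u v (W i) (F i))
    (hW : ∀ i j, i ≠ j → (W i ∩ W j : Finset α) = {u, v})
    (hF : ∀ i j, i ≠ j → Disjoint (F i) (F j)) :
    ∃ D ≤ G, D.IsDiamond := by
  have hsW : ∀ i, W i ⊆ Finset.univ.biUnion W := fun i =>
    Finset.subset_biUnion_of_mem W (Finset.mem_univ i)
  have hsF : ∀ i, F i ⊆ Finset.univ.biUnion F := fun i =>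
    Finset.subset_biUnion_of_mem F (Finset.mem_univ i)
  have hE : ∀ i, E((G.restrict (F i)).induce (W i)) = F i := fun i =>
    edgeSet_induce_restrict_subset.antisymm
      ((hP i).edgeSet_induce_restrict subset_rfl subset_rfl)
  have hle : ∀ i, (G.restrict (F i)).induce (W i) ≤ G := fun i =>
    (induce_le (G := G.restrict (F i)) fun a ha => (hP i).mem_vertexSet ha).trans restrict_le
  refine ⟨(G.restrict (Finset.univ.biUnion F : Finset β)).induce
    (Finset.univ.biUnion W : Finset α), ?_, u, v,
    fun i => (G.restrict (F i)).induce (W i), huv, fun i => ⟨?_, ?_⟩, fun i j hij => ⟨?_, ?_⟩,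
    ?_, ?_⟩
  · refine (induce_le (G := G.restrict (Finset.univ.biUnion F : Finset β))
      fun a ha => ?_).trans restrict_le
    simp only [Finset.coe_biUnion, Set.mem_iUnion] at ha
    obtain ⟨i, -, hi⟩ := ha
    exact (hP i).mem_vertexSet hi
  · exact induce_restrict_mono (hsW i) (hsF i)
  · exact (hP i).isPathBetween rfl (hE i) (hle i)
  · have := hW i j hij
    simpa using congrArg (fun s : Finset α => (s : Set α)) this
  · rw [hE, hE]
    exact_mod_cast hF i j hij
  · simp
  · simp only [hE]
    refine Set.Subset.antisymm (edgeSet_induce_restrict_subset.trans (by simp)) ?_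
    exact Set.iUnion_subset fun i => (hP i).edgeSet_induce_restrict (hsF i) (hsW i)

/-- Three pairwise edge-disjoint connections between two distinct vertices yield a diamond. -/
theorem exists_isDiamond_of_edgeConn {u v : α} (huv : u ≠ v) {A B C : Finset β}
    (hAB : Disjoint A B) (hAC : Disjoint A C) (hBC : Disjoint B C) (hA : G.EdgeConn A u v)
    (hB : G.EdgeConn B u v) (hC : G.EdgeConn C u v) : ∃ D ≤ G, D.IsDiamond := by
  induction hk : A.card + B.card + C.card using Nat.strong_induction_on
    generalizing u v A B C with
  | _ k ih =>
  have hv : v ∈ V(G) := hA.symm.left_mem huv.symm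
  obtain ⟨WA, A', hA', PA⟩ := PathOn.exists_of_edgeConn hA hv
  obtain ⟨WB, B', hB', PB⟩ := PathOn.exists_of_edgeConn hB hv
  obtain ⟨WC, C', hC', PC⟩ := PathOn.exists_of_edgeConn hC hv
  -- If two of the paths meet in an inner vertex `w`, replace `v` by `w`: two connections stop at
  -- `w`, and the third one reaches `v` through `C` and returns to `w` along `A₂`. The edges of `B₂`
  -- are saved, so the total decreases.
  have step : ∀ {W₁ W₂ : Finset α} {A B A' B' C : Finset β}, A' ⊆ A → B' ⊆ B → Disjoint A B →
      Disjoint A C → Disjoint B C → A.card + B.card + C.card = k → G.PathOn u v W₁ A' →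
      G.PathOn u v W₂ B' → G.EdgeConn C u v → (∃ D ≤ G, D.IsDiamond) ∨ W₁ ∩ W₂ = {u, v} := by
    intro W₁ W₂ A B A' B' C hA' hB' hAB hAC hBC hk P₁ P₂ hC
    by_cases hw : ∃ w, w ∈ W₁ ∩ W₂ ∧ w ≠ u ∧ w ≠ v
    · left
      obtain ⟨w, hw, hwu, hwv⟩ := hw
      rw [Finset.mem_inter] at hw
      obtain ⟨_, _, A₁, A₂, PA₁, PA₂, -, rfl, hA₁₂⟩ := P₁.split hw.1
      obtain ⟨_, _, B₁, B₂, PB₁, PB₂, -, rfl, hB₁₂⟩ := P₂.split hw.2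
      have hc₁ : A₁.card + A₂.card ≤ A.card := by
        rw [← Finset.card_union_of_disjoint hA₁₂]; exact Finset.card_le_card hA'
      have hc₂ : B₁.card + B₂.card ≤ B.card := by
        rw [← Finset.card_union_of_disjoint hB₁₂]; exact Finset.card_le_card hB'
      have hc₃ : 0 < B₂.card := (PB₂.edgeConn.nonempty hwv).card_pos
      have hc₄ := Finset.card_union_le C A₂
      have hA₁ : A₁ ⊆ A := Finset.union_subset_left hA'
      have hA₂ : A₂ ⊆ A := Finset.union_subset_right hA'
      have hB₁ : B₁ ⊆ B := Finset.union_subset_left hB'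
      refine ih (A₁.card + B₁.card + (C ∪ A₂).card) (by omega) hwu.symm
        (hAB.mono hA₁ hB₁) ?_ ?_ PA₁.edgeConn PB₁.edgeConn ?_ _root_.rfl
      · exact Finset.disjoint_union_right.2 ⟨hAC.mono_left hA₁, hA₁₂⟩
      · exact Finset.disjoint_union_right.2 ⟨hBC.mono_left hB₁, (hAB.mono hA₂ hB₁).symm⟩
      · exact (hC.mono Finset.subset_union_left).trans
          (PA₂.edgeConn.symm.mono Finset.subset_union_right)
    · right
      push Not at hw
      ext w
      simp only [Finset.mem_insert, Finset.mem_singleton]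
      refine ⟨fun h => ?_, ?_⟩
      · by_contra hne
        exact hne (or_iff_not_imp_left.2 (hw w h))
      · rintro (rfl | rfl)
        · exact Finset.mem_inter.2 ⟨P₁.left_mem, P₂.left_mem⟩
        · exact Finset.mem_inter.2 ⟨P₁.right_mem, P₂.right_mem⟩
  rcases step hA' hB' hAB hAC hBC hk PA PB hC with h | hWAB
  · exact h
  rcases step hA' hC' hAC hAB hBC.symm (by omega) PA PC hB with h | hWAC
  · exact h
  rcases step hB' hC' hBC hAB.symm hAC.symm (by omega) PB PC hA with h | hWBC
  · exact h
  refine exists_isDiamond_of_pathOn huv ![WA, WB, WC] ![A', B', C'] ?_ ?_ ?_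
  · intro i; fin_cases i <;> assumption
  · intro i j hij
    fin_cases i <;> fin_cases j <;> first | exact absurd _root_.rfl hij | skip
    · exact hWAB
    · exact hWAC
    · exact (Finset.inter_comm _ _).trans hWAB
    · exact hWBC
    · exact (Finset.inter_comm _ _).trans hWAC
    · exact (Finset.inter_comm _ _).trans hWBC
  · intro i j hij
    fin_cases i <;> fin_cases j <;> first | exact absurd _root_.rfl hij | skip
    · exact hAB.mono hA' hB'
    · exact hAC.mono hA' hC'
    · exact (hAB.mono hA' hB').symm
    · exact hBC.mono hB' hC'
    · exact (hAC.mono hA' hC').symm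
    · exact (hBC.mono hB' hC').symm

/-- Three vertices connected by edges of `F` are the ends of a tripod in `F`. -/
theorem EdgeConn.exists_tripod {a b c : α} {F : Finset β} (ha : a ∈ V(G)) (hb : G.EdgeConn F b a)
    (hc : G.EdgeConn F c a) : ∃ (m : α) (A B C : Finset β), A ⊆ F ∧ B ⊆ F ∧ C ⊆ F ∧
      Disjoint A B ∧ Disjoint A C ∧ Disjoint B C ∧ G.EdgeConn A m a ∧ G.EdgeConn B m b ∧
      G.EdgeConn C m c := by
  obtain ⟨W, P, hP, hpath⟩ := PathOn.exists_of_edgeConn hb ha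
  -- The centre is the first vertex of the connection from `c` that lies on the path. Each edge
  -- before it has an end off the path, so it is not a path edge.
  have key : ∃ m ∈ W, ∃ C ⊆ F, Disjoint C P ∧ G.EdgeConn C m c := by
    induction hc using Relation.ReflTransGen.head_induction_on with
    | refl => exact ⟨a, hpath.right_mem, ∅, by simp, by simp, .rfl⟩
    | @head x y hxy _ ih =>
      by_cases hx : x ∈ W
      · exact ⟨x, hx, ∅, by simp, by simp, .rfl⟩
      · obtain ⟨e, he, hl⟩ := hxy
        obtain ⟨m, hm, C, hC, hCP, hconn⟩ := ih
        refine ⟨m, hm, insert e C, Finset.insert_subset he hC, ?_, ?_⟩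
        · rw [Finset.disjoint_insert_left]
          exact ⟨fun he' => hx (hpath.mem_of_isLink he' hl), hCP⟩
        · exact (hconn.mono (Finset.subset_insert _ _)).trans
            (.of_isLink (Finset.mem_insert_self _ _) hl.symm)
  obtain ⟨m, hm, C, hC, hCP, hconn⟩ := key
  obtain ⟨_, _, B, A, hB, hA, -, rfl, hBA⟩ := hpath.split hm
  rw [Finset.disjoint_union_right] at hCP
  exact ⟨m, A, B, C, Finset.union_subset_right hP, Finset.union_subset_left hP, hC, hBA.symm,
    hCP.2.symm, hCP.1.symm, hA.edgeConn, hB.edgeConn.symm, hconn⟩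

/-- Three edges leaving a set `S` yield a diamond if their ends inside `S` are connected within
`S` and their ends outside `S` are connected outside `S`. -/
theorem exists_isDiamond_of_cut {S : Set α} {FA FB : Finset β} {a b : Fin 3 → α} {e : Fin 3 → β}
    (he : Function.Injective e) (hl : ∀ i, G.IsLink (e i) (a i) (b i)) (ha : ∀ i, a i ∈ S)
    (hb : ∀ i, b i ∉ S) (hFA : ∀ f ∈ FA, ∃ x y, G.IsLink f x y ∧ x ∈ S ∧ y ∈ S)
    (hFB : ∀ f ∈ FB, ∃ x y, G.IsLink f x y ∧ x ∉ S ∧ y ∉ S)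
    (hA : ∀ i, G.EdgeConn FA (a i) (a 0)) (hB : ∀ i, G.EdgeConn FB (b i) (b 0)) :
    ∃ D ≤ G, D.IsDiamond := by
  have hSA : ∀ f ∈ FA, ∀ x y, G.IsLink f x y → x ∈ S := by
    intro f hf x y hxy
    obtain ⟨x', y', hl', hx', hy'⟩ := hFA f hf
    rcases hxy.left_eq_or_eq hl' with rfl | rfl <;> assumption
  have hSB : ∀ f ∈ FB, ∀ x y, G.IsLink f x y → x ∈ Sᶜ := by
    intro f hf x y hxy
    obtain ⟨x', y', hl', hx', hy'⟩ := hFB f hf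
    rcases hxy.left_eq_or_eq hl' with rfl | rfl <;> assumption
  have heA : ∀ i, e i ∉ FA := fun i h => hb i (hSA _ h _ _ (hl i).symm)
  have heB : ∀ i, e i ∉ FB := fun i h => hSB _ h _ _ (hl i) (ha i)
  have hAB : Disjoint FA FB := by
    rw [Finset.disjoint_left]
    intro f hf hf'
    obtain ⟨x, y, hxy, -⟩ := hFA f hf
    exact hSB f hf' _ _ hxy (hSA f hf _ _ hxy)
  -- A tripod on each side of the cut: its legs, linked by the three cut edges, form three
  -- edge-disjoint connections between the two centres.
  obtain ⟨m, A₀, A₁, A₂, hA₀, hA₁, hA₂, hA01, hA02, hA12, cA₀, cA₁, cA₂⟩ :=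
    EdgeConn.exists_tripod (hl 0).left_mem (hA 1) (hA 2)
  obtain ⟨m', B₀, B₁, B₂, hB₀, hB₁, hB₂, hB01, hB02, hB12, cB₀, cB₁, cB₂⟩ :=
    EdgeConn.exists_tripod (hl 0).right_mem (hB 1) (hB 2)
  have hm : m ∈ S := (cA₀.mono hA₀).symm.mem_of_mem hSA (ha 0)
  have hm' : m' ∈ Sᶜ := (cB₀.mono hB₀).symm.mem_of_mem hSB (hb 0)
  have hne : m ≠ m' := fun h => hm' (h ▸ hm)
  have conn : ∀ i {A B : Finset β}, G.EdgeConn A m (a i) → G.EdgeConn B m' (b i) →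
      G.EdgeConn (insert (e i) (A ∪ B)) m m' := by
    intro i A B h h'
    refine (h.mono ?_).trans ((EdgeConn.of_isLink (Finset.mem_insert_self _ _) (hl i)).trans
      (h'.symm.mono ?_))
    · exact Finset.subset_union_left.trans (Finset.subset_insert _ _)
    · exact Finset.subset_union_right.trans (Finset.subset_insert _ _)
  have disj : ∀ i j {A B A' B' : Finset β}, i ≠ j → A ⊆ FA → A' ⊆ FA → B ⊆ FB → B' ⊆ FB →
      Disjoint A A' → Disjoint B B' →
      Disjoint (insert (e i) (A ∪ B)) (insert (e j) (A' ∪ B')) := by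
    intro i j A B A' B' hij h₁ h₂ h₃ h₄ h₅ h₆
    simp only [Finset.disjoint_insert_left, Finset.disjoint_insert_right, Finset.mem_insert,
      Finset.mem_union, Finset.disjoint_union_left, Finset.disjoint_union_right, not_or]
    exact ⟨⟨he.ne hij.symm, fun h => heA j (h₁ h), fun h => heB j (h₃ h)⟩,
      ⟨fun h => heA i (h₂ h), h₅, (hAB.mono h₂ h₃).symm⟩,
      fun h => heB i (h₄ h), (hAB.mono h₁ h₄), h₆⟩
  exact exists_isDiamond_of_edgeConn hne
    (disj 0 1 (by decide) hA₀ hA₁ hB₀ hB₁ hA01 hB01)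
    (disj 0 2 (by decide) hA₀ hA₂ hB₀ hB₂ hA02 hB02)
    (disj 1 2 (by decide) hA₁ hA₂ hB₁ hB₂ hA12 hB12) (conn 0 cA₀ cB₀) (conn 1 cA₁ cB₁)
    (conn 2 cA₂ cB₂)

end Paths

/-! ### Vertex-weighted walks and Voronoi cells -/

section WeightedReach

variable {α M : Type*}

/-- There is a walk from `s` along `r` of total vertex weight `k`, both ends included. -/
inductive WReach [Add M] (r : α → α → Prop) (y : α → M) (s : α) : α → M → Prop
  | refl : WReach r y s s (y s)
  | step {a b : α} {k : M} (h : WReach r y s a k) (hab : r a b) : WReach r y s b (k + y b)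

namespace WReach

theorem mono [Add M] {r r' : α → α → Prop} {y : α → M} {s a : α} {k : M} (h : WReach r y s a k)
    (hr : ∀ a b, r a b → r' a b) : WReach r' y s a k := by
  induction h with
  | refl => exact .refl
  | step _ hab ih => exact .step ih (hr _ _ hab)

theorem exists_of_reflTransGen [Add M] {r : α → α → Prop} {y : α → M} {s a : α}
    (h : Relation.ReflTransGen r s a) : ∃ k, WReach r y s a k := by
  induction h with
  | refl => exact ⟨_, .refl⟩
  | tail _ hab ih => exact ⟨_, .step ih.choose_spec hab⟩

theorem reflTransGen [Add M] {r : α → α → Prop} {y : α → M} {s a : α} {k : M}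
    (h : WReach r y s a k) : Relation.ReflTransGen r s a := by
  induction h with
  | refl => exact .refl
  | step _ hab ih => exact .tail ih hab

theorem head [AddCommMonoid M] {r : α → α → Prop} {y : α → M} {s a b : α} {k : M}
    (h : WReach r y s a k) (hb : r b s) : WReach r y b a (k + y b) := by
  induction h with
  | refl => rw [add_comm]; exact .step .refl hb
  | step _ hab ih => rw [add_right_comm]; exact .step ih hab

theorem symm [AddCommMonoid M] {r : α → α → Prop} (hr : ∀ a b, r a b → r b a) {y : α → M}
    {s a : α} {k : M} (h : WReach r y s a k) : WReach r y a s k := by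
  induction h with
  | refl => exact .refl
  | step _ hab ih => exact ih.head (hr _ _ hab)

theorem trans {r : α → α → Prop} {y : α → ℕ} {s a b : α} {k k' : ℕ} (h : WReach r y s a k)
    (h' : WReach r y a b k') : ∃ l ≤ k + k', WReach r y s b l := by
  induction h' with
  | refl => exact ⟨k, by omega, h⟩
  | step _ hab ih =>
    obtain ⟨l, hl, hw⟩ := ih
    exact ⟨_, by omega, hw.step hab⟩

section Order

variable [AddCommMonoid M] [LinearOrder M] {r : α → α → Prop} {y : α → M} {s u v a : α} {k : M}

/-- The cell of `u` against `v`: the vertices whose distance `k` from `u` is related by `R` to all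
weights of walks from `v`. -/
def cell (r : α → α → Prop) (y : α → M) (R : M → M → Prop) (u v : α) : Set α :=
  {w | ∃ k, WReach r y u w k ∧ (∀ k', WReach r y u w k' → k ≤ k') ∧
    ∀ k', WReach r y v w k' → R k k'}

theorem exists_min [WellFoundedLT M] (h : ∃ k, WReach r y u a k) :
    ∃ k, WReach r y u a k ∧ ∀ k', WReach r y u a k' → k ≤ k' := by
  obtain ⟨k, hk, hmin⟩ := WellFounded.has_min (wellFounded_lt (α := M))
    {k | WReach r y u a k} h
  exact ⟨k, hk, fun k' hk' => not_lt.1 (hmin k' hk')⟩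

/-- Using `≤` for one centre and `<` for the other settles ties, so the two cells are disjoint and,
by `cell_le_or_lt`, cover everything reachable from both centres. -/
theorem not_mem_cell_of_mem_cell (h : a ∈ cell r y (· < ·) v u) :
    a ∉ cell r y (· ≤ ·) u v := by
  rintro ⟨k, hk, -, hkl⟩
  obtain ⟨l, hl, -, hlk⟩ := h
  exact (hlk k hk).not_ge (hkl l hl)

theorem cell_le_or_lt [WellFoundedLT M] (hu : ∃ k, WReach r y u a k)
    (hv : ∃ k, WReach r y v a k) : a ∈ cell r y (· ≤ ·) u v ∨ a ∈ cell r y (· < ·) v u := by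
  obtain ⟨k, hk, hkm⟩ := exists_min hu
  obtain ⟨l, hl, hlm⟩ := exists_min hv
  rcases le_or_gt k l with h | h
  · exact .inl ⟨k, hk, hkm, fun k' hk' => h.trans (hlm _ hk')⟩
  · exact .inr ⟨l, hl, hlm, fun k' hk' => h.trans_le (hkm _ hk')⟩

variable [IsOrderedCancelAddMonoid M]

theorem pos (hy : ∀ a, 0 < y a) (h : WReach r y s a k) : 0 < k := by
  induction h with
  | refl => exact hy _
  | step _ _ ih => exact add_pos ih (hy _)

theorem weight_le (hy : ∀ a, 0 < y a) (h : WReach r y s a k) : y a ≤ k := by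
  cases h with
  | refl => exact le_rfl
  | step h _ => exact le_add_of_nonneg_left (h.pos hy).le

theorem weight_lt (hy : ∀ a, 0 < y a) (h : WReach r y s a k) (hsa : s ≠ a) : y a < k := by
  cases h with
  | refl => exact absurd rfl hsa
  | step h _ => exact lt_add_of_pos_left _ (h.pos hy)

/-- Shortest walks towards a vertex of a cell stay inside this cell. -/
theorem restrict_cell {R : M → M → Prop} (hR : ∀ a b c, R (a + c) (b + c) → R a b)
    (h : WReach r y u a k) (hmin : ∀ k', WReach r y u a k' → k ≤ k')
    (hdom : ∀ k', WReach r y v a k' → R k k') :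
    WReach (fun a b => r a b ∧ a ∈ cell r y R u v ∧ b ∈ cell r y R u v) y u a k := by
  induction h with
  | refl => exact .refl
  | @step a b k h hab ih =>
    -- A competing walk to `a` extends to `b` at the same extra weight, so by cancellation both
    -- properties of the walk to `b` pass to its initial part.
    have hmin' : ∀ k', WReach r y u a k' → k ≤ k' := fun k' hk' =>
      le_of_add_le_add_right (hmin _ (hk'.step hab))
    have hdom' : ∀ k', WReach r y v a k' → R k k' := fun k' hk' =>
      hR _ _ _ (hdom _ (hk'.step hab))
    exact .step (ih hmin' hdom') ⟨hab, ⟨k, h, hmin', hdom'⟩, ⟨_, h.step hab, hmin, hdom⟩⟩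

theorem mem_cell_self (hy : ∀ a, 0 < y a) : u ∈ cell r y (· ≤ ·) u v :=
  ⟨y u, .refl, fun _ h => h.weight_le hy, fun _ h => h.weight_le hy⟩

/-- If weights could vanish, a walk from `u` to `v` might weigh no more than `v` alone, and `v`
would be lost to the other cell. This is why `lexWeight` is used, which is positive even where `y`
is zero. -/
theorem mem_cell_lt_self (hy : ∀ a, 0 < y a) (huv : u ≠ v) : v ∈ cell r y (· < ·) v u :=
  ⟨y v, .refl, fun _ h => h.weight_le hy, fun _ h => h.weight_lt hy huv⟩

end Order

/-- Ties between walks of equal weight are broken by the number of vertices. -/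
def lexWeight (y : α → ℕ) (a : α) : ℕ ×ₗ ℕ := toLex (y a, 1)

theorem lexWeight_pos (y : α → ℕ) (a : α) : 0 < lexWeight y a := by
  rw [Prod.Lex.lt_iff]
  rcases Nat.eq_zero_or_pos (y a) with h | h
  · exact .inr ⟨by simpa [lexWeight] using h.symm, by simp [lexWeight]⟩
  · exact .inl (by simpa [lexWeight] using h)

theorem exists_lexWeight {r : α → α → Prop} {y : α → ℕ} {s a : α} {k : ℕ}
    (h : WReach r y s a k) : ∃ l, WReach r (lexWeight y) s a l ∧ (ofLex l).1 = k := by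
  induction h with
  | refl => exact ⟨_, .refl, rfl⟩
  | @step a b k _ hab ih =>
    obtain ⟨l, hl, rfl⟩ := ih
    exact ⟨_, hl.step hab, rfl⟩

theorem of_lexWeight {r : α → α → Prop} {y : α → ℕ} {s a : α} {l : ℕ ×ₗ ℕ}
    (h : WReach r (lexWeight y) s a l) : WReach r y s a (ofLex l).1 := by
  induction h with
  | refl => exact .refl
  | step _ hab ih => exact .step ih hab

/-- In a cell, there are light walks from its centre. -/
theorem exists_le_of_mem_cell {r : α → α → Prop} {y : α → ℕ} {R : ℕ ×ₗ ℕ → ℕ ×ₗ ℕ → Prop}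
    (hR : ∀ a b c, R (a + c) (b + c) → R a b) {u v a : α} {m : ℕ}
    (hm : ∃ k ≤ m, WReach r y u a k) (ha : a ∈ cell r (lexWeight y) R u v) :
    ∃ k ≤ m, WReach (fun a b => r a b ∧ a ∈ cell r (lexWeight y) R u v ∧
      b ∈ cell r (lexWeight y) R u v) y u a k := by
  obtain ⟨l, hl, hmin, hdom⟩ := ha
  obtain ⟨k, hkm, hk⟩ := hm
  obtain ⟨l', hl', rfl⟩ := hk.exists_lexWeight
  -- A lexicographically minimal walk also minimises the first coordinate, so the tie-breaking costs
  -- no weight.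
  refine ⟨(ofLex l).1, le_trans ?_ hkm, (hl.restrict_cell hR hmin hdom).of_lexWeight⟩
  exact Prod.Lex.monotone_fst _ _ (hmin _ hl')

theorem exists_finset [DecidableEq α] {r : α → α → Prop} {S : Set α} {y : α → ℕ} {s a : α} {k : ℕ}
    (h : WReach (fun a b => r a b ∧ a ∈ S ∧ b ∈ S) y s a k) (hs : s ∈ S) :
    ∃ W : Finset α, s ∈ W ∧ a ∈ W ∧ (W : Set α) ⊆ S ∧ ∑ w ∈ W, y w ≤ k ∧
      Relation.ReflTransGen (fun a b => r a b ∧ a ∈ W ∧ b ∈ W) s a := by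
  induction h with
  | refl => exact ⟨{s}, by simp, by simp, by simpa using hs, by simp, .refl⟩
  | @step a b k _ hab ih =>
    obtain ⟨W, hsW, haW, hWS, hk, hconn⟩ := ih
    refine ⟨insert b W, by simp [hsW], by simp, ?_, ?_, ?_⟩
    · rw [Finset.coe_insert]
      exact Set.insert_subset hab.2.2 hWS
    · by_cases hb : b ∈ W
      · rw [Finset.insert_eq_of_mem hb]; omega
      · rw [Finset.sum_insert hb]; omega
    · refine .tail (Relation.ReflTransGen.mono ?_ _ _ hconn) ⟨hab.1, by simp [haW], by simp⟩
      exact fun x z h => ⟨h.1, Finset.mem_insert_of_mem h.2.1, Finset.mem_insert_of_mem h.2.2⟩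

end WReach

end WeightedReach

/-! ### From an arbitrary diamond to a light one -/

section LightDiamond

variable {α β : Type*} {G : Graph α β}

theorem image_univ_fin_succ {γ : Type*} [DecidableEq γ] {m : ℕ} (f : Fin (m + 1) → γ) :
    Finset.univ.image f = insert (f 0) (Finset.univ.image fun i : Fin m => f i.succ) := by
  ext a
  simp [Fin.exists_fin_succ, eq_comm]

theorem PathOn.of_fin [DecidableEq α] [DecidableEq β] {n : ℕ} {x : Fin (n + 1) → α}
    {e : Fin n → β} (hx : Function.Injective x) (h0 : x 0 ∈ V(G))
    (hl : ∀ i : Fin n, G.IsLink (e i) (x i.castSucc) (x i.succ)) :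
    G.PathOn (x 0) (x (Fin.last n)) (Finset.univ.image x) (Finset.univ.image e) := by
  induction n with
  | zero => simpa using PathOn.nil h0
  | succ n ih =>
    have hP := ih (x := fun i => x i.succ) (e := fun i => e i.succ)
      (hx.comp (Fin.succ_injective _)) (hl 0).right_mem (fun i => hl i.succ)
    have := PathOn.cons (hl 0) hP (by simp [hx.eq_iff])
    rw [image_univ_fin_succ x, image_univ_fin_succ e]
    exact this

theorem IsPathBetween.exists_pathOn [DecidableEq α] [DecidableEq β] {P : Graph α β} {u v : α}
    (h : P.IsPathBetween u v) :
    ∃ (W : Finset α) (F : Finset β), (F : Set β) = E(P) ∧ P.PathOn u v W F := by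
  obtain ⟨n, x, e, hx, rfl, rfl, hV, hE, hlink⟩ := h
  exact ⟨_, _, by simp [hE], PathOn.of_fin hx (by simp [hV]) hlink⟩

theorem PathOn.of_le [DecidableEq α] [DecidableEq β] {H : Graph α β} {u v : α} {W : Finset α}
    {F : Finset β} (h : H.PathOn u v W F) (hle : H ≤ G) : G.PathOn u v W F := by
  induction h with
  | nil hu => exact .nil (hle.vertexSet_mono hu)
  | cons hl _ hu ih => exact .cons (hl.mono hle) ih hu

theorem EdgeConn.reflTransGen_adj {F : Finset β} {u v : α} (h : G.EdgeConn F u v) :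
    Relation.ReflTransGen G.Adj u v :=
  Relation.ReflTransGen.mono (fun _ _ ⟨e, _, hl⟩ => ⟨e, hl⟩) _ _ h

theorem IsDiamond.exists_pathOn [DecidableEq α] [DecidableEq β] {D : Graph α β}
    (hD : D.IsDiamond) : ∃ (u v : α) (W : Fin 3 → Finset α) (F : Fin 3 → Finset β), u ≠ v ∧
      (∀ i, D.PathOn u v (W i) (F i)) ∧ (∀ i j, i ≠ j → Disjoint (F i) (F j)) ∧
      E(D) = ⋃ i, (F i : Set β) := by
  obtain ⟨u, v, P, huv, hP, hdisj, -, hE⟩ := hD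
  choose W F hF hFc using fun i => (hP i).2.exists_pathOn
  refine ⟨u, v, W, F, huv, fun i => (hFc i).of_le (hP i).1, fun i j hij => ?_, by simp [hE, hF]⟩
  have := (hdisj i j hij).2
  rw [← hF, ← hF] at this
  exact_mod_cast this

/-- If connected vertices are always connected by a walk of weight at most `m`, then the existence
of a diamond implies the existence of a diamond of weight at most `6 * m`. -/
theorem IsDiamond.exists_light [DecidableEq α] [DecidableEq β] {D : Graph α β} (hD : D.IsDiamond)
    (hDG : D ≤ G) (hE : E(G).Finite) {y : α → ℕ} {m : ℕ}
    (hm : ∀ u ∈ V(G), ∀ v, Relation.ReflTransGen G.Adj u v → ∃ k ≤ m, WReach G.Adj y u v k) :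
    ∃ (D' : Graph α β) (W : Finset α), D' ≤ G ∧ D'.IsDiamond ∧ V(D') ⊆ W ∧
      ∑ w ∈ W, y w ≤ 6 * m := by
  obtain ⟨u, v, W, F, huv, hF, hdisj, -⟩ := hD.exists_pathOn
  replace hF := fun i => (hF i).edgeConn.of_le hDG
  have huG : u ∈ V(G) := (hF 0).left_mem huv
  have hvG : v ∈ V(G) := (hF 0).symm.left_mem huv.symm
  set A := WReach.cell G.Adj (WReach.lexWeight y) (· ≤ ·) u v with hAdef
  set B := WReach.cell G.Adj (WReach.lexWeight y) (· < ·) v u with hBdef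
  have hBA : ∀ b ∈ B, b ∉ A := fun b hb => WReach.not_mem_cell_of_mem_cell hb
  have huA : u ∈ A := WReach.mem_cell_self (WReach.lexWeight_pos y)
  have hvB : v ∈ B := WReach.mem_cell_lt_self (WReach.lexWeight_pos y) huv
  choose e heF a ha b hb hl hub using
    fun i => (hF i).exists_isLink_of_mem_of_notMem huA (hBA v hvB)
  have hvb : ∀ i, G.EdgeConn (F i) v (b i) := fun i => (hF i).symm.trans (hub i)
  have hua : ∀ i, Relation.ReflTransGen G.Adj u (a i) := fun i =>
    (hub i).reflTransGen_adj.tail ⟨e i, (hl i).symm⟩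
  -- `b i` is reachable from both ends and outside the cell of `u`, which leaves the cell of `v`.
  have hbB : ∀ i, b i ∈ B := fun i =>
    (WReach.cell_le_or_lt (WReach.exists_of_reflTransGen (hub i).reflTransGen_adj)
      (WReach.exists_of_reflTransGen (hvb i).reflTransGen_adj)).resolve_left (hb i)
  have hWA : ∀ i, ∃ W : Finset α, u ∈ W ∧ a i ∈ W ∧ (W : Set α) ⊆ A ∧ ∑ w ∈ W, y w ≤ m ∧
      Relation.ReflTransGen (fun a b => G.Adj a b ∧ a ∈ W ∧ b ∈ W) u (a i) := by
    intro i
    obtain ⟨k, hk, hw⟩ := WReach.exists_le_of_mem_cell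
      (fun _ _ _ h => le_of_add_le_add_right h) (hm _ huG _ (hua i)) (ha i)
    obtain ⟨W, h₁, h₂, h₃, h₄, h₅⟩ := hw.exists_finset huA
    exact ⟨W, h₁, h₂, h₃, h₄.trans hk, h₅⟩
  have hWB : ∀ i, ∃ W : Finset α, v ∈ W ∧ b i ∈ W ∧ (W : Set α) ⊆ B ∧ ∑ w ∈ W, y w ≤ m ∧
      Relation.ReflTransGen (fun a b => G.Adj a b ∧ a ∈ W ∧ b ∈ W) v (b i) := by
    intro i
    obtain ⟨k, hk, hw⟩ := WReach.exists_le_of_mem_cell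
      (fun _ _ _ h => lt_of_add_lt_add_right h) (hm _ hvG _ (hvb i).reflTransGen_adj) (hbB i)
    obtain ⟨W, h₁, h₂, h₃, h₄, h₅⟩ := hw.exists_finset hvB
    exact ⟨W, h₁, h₂, h₃, h₄.trans hk, h₅⟩
  choose WA huW haW hWAA hWAm hWAc using hWA
  choose WB hvW hbW hWBB hWBm hWBc using hWB
  set UA := Finset.univ.biUnion WA
  set UB := Finset.univ.biUnion WB
  have hUA : (UA : Set α) ⊆ A := by simpa [UA] using hWAA
  have hUB : (UB : Set α) ⊆ B := by simpa [UB] using hWBB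
  have hiA : ∀ i, WA i ⊆ UA := fun i => Finset.subset_biUnion_of_mem _ (Finset.mem_univ i)
  have hiB : ∀ i, WB i ⊆ UB := fun i => Finset.subset_biUnion_of_mem _ (Finset.mem_univ i)
  classical
  let inner : Finset α → Finset β := fun U =>
    hE.toFinset.filter fun e => ∃ x z, G.IsLink e x z ∧ x ∈ U ∧ z ∈ U
  -- Working in `K` confines the new diamond to the vertices of the six light walks.
  let K := G.induce ((UA ∪ UB : Finset α) : Set α)
  have hinner : ∀ {U W : Finset α} {s t : α}, U ⊆ UA ∪ UB → W ⊆ U →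
      Relation.ReflTransGen (fun a b => G.Adj a b ∧ a ∈ W ∧ b ∈ W) s t →
      K.EdgeConn (inner U) s t := by
    intro U W s t hU hW h
    refine Relation.ReflTransGen.mono ?_ _ _ h
    rintro x z ⟨⟨f, hf⟩, hx, hz⟩
    refine ⟨f, ?_, hf, hU (hW hx), hU (hW hz)⟩
    simp only [inner, Finset.mem_filter, Set.Finite.mem_toFinset]
    exact ⟨hf.edge_mem, x, z, hf, hW hx, hW hz⟩
  have hVG : ((UA ∪ UB : Finset α) : Set α) ⊆ V(G) := by
    have hG : ∀ {s x : α}, s ∈ V(G) → Relation.ReflTransGen G.Adj s x → x ∈ V(G) := by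
      intro s x hs h
      rcases h.cases_tail with h | ⟨z, -, h⟩
      · exact h ▸ hs
      · exact h.right_mem
    intro x hx
    rcases Finset.mem_union.1 hx with hx | hx
    · obtain ⟨k, hk, -⟩ := hUA hx
      exact hG huG hk.reflTransGen
    · obtain ⟨k, hk, -⟩ := hUB hx
      exact hG hvG hk.reflTransGen
  have hmem : ∀ i, K.IsLink (e i) (a i) (b i) := fun i => ⟨hl i,
    Finset.mem_union_left _ (hiA i (haW i)), Finset.mem_union_right _ (hiB i (hbW i))⟩
  have heinj : Function.Injective e := by
    intro i j hij
    by_contra hne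
    exact Finset.disjoint_left.1 (hdisj i j hne) (heF i) (hij ▸ heF j)
  have hcA : ∀ i, K.EdgeConn (inner UA) u (a i) := fun i =>
    hinner Finset.subset_union_left (hiA i) (hWAc i)
  have hcB : ∀ i, K.EdgeConn (inner UB) v (b i) := fun i =>
    hinner Finset.subset_union_right (hiB i) (hWBc i)
  obtain ⟨D', hD'K, hD'⟩ := exists_isDiamond_of_cut (G := K) (S := A) (FA := inner UA)
    (FB := inner UB) heinj hmem ha hb
    (fun f hf => by
      simp only [inner, Finset.mem_filter] at hf
      obtain ⟨-, x, z, hxz, hx, hz⟩ := hf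
      exact ⟨x, z, ⟨hxz, Finset.mem_union_left _ hx, Finset.mem_union_left _ hz⟩,
        hUA hx, hUA hz⟩)
    (fun f hf => by
      simp only [inner, Finset.mem_filter] at hf
      obtain ⟨-, x, z, hxz, hx, hz⟩ := hf
      exact ⟨x, z, ⟨hxz, Finset.mem_union_right _ hx, Finset.mem_union_right _ hz⟩,
        hBA _ (hUB hx), hBA _ (hUB hz)⟩)
    (fun i => (hcA i).symm.trans (hcA 0)) (fun i => (hcB i).symm.trans (hcB 0))
  refine ⟨D', UA ∪ UB, hD'K.trans (induce_le hVG), hD', hD'K.vertexSet_mono, ?_⟩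
  have hunion : ∀ s t : Finset α, ∑ w ∈ s ∪ t, y w ≤ ∑ w ∈ s, y w + ∑ w ∈ t, y w := fun s t => by
    rw [← Finset.sum_union_inter]; exact Nat.le_add_right _ _
  have h₁ := hunion UA UB
  have h₂ := hunion (WA 0) (WA 1 ∪ WA 2)
  have h₃ := hunion (WA 1) (WA 2)
  have h₄ := hunion (WB 0) (WB 1 ∪ WB 2)
  have h₅ := hunion (WB 1) (WB 2)
  have h₆ := hWAm 0
  have h₇ := hWAm 1
  have h₈ := hWAm 2
  have h₉ := hWBm 0
  have h₁₀ := hWBm 1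
  have h₁₁ := hWBm 2
  have hUA' : ∑ w ∈ UA, y w = ∑ w ∈ WA 0 ∪ (WA 1 ∪ WA 2), y w := by
    congr 1; ext; simp [UA, Fin.exists_fin_succ]
  have hUB' : ∑ w ∈ UB, y w = ∑ w ∈ WB 0 ∪ (WB 1 ∪ WB 2), y w := by
    congr 1; ext; simp [UB, Fin.exists_fin_succ]
  omega

end LightDiamond

/-! ### Region growing with vertex weights -/

section RegionGrowing

variable {α : Type*}

open Classical in
/-- The vertices of `V` at distance at most `t` from `s`. -/
noncomputable def ballIn (r : α → α → Prop) (y : α → ℕ) (V : Finset α) (s : α) (t : ℕ) :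
    Finset α :=
  V.filter fun v => ∃ k ≤ t, WReach (fun a b => r a b ∧ a ∈ V ∧ b ∈ V) y s v k

open Classical in
/-- The vertices of `V` whose weight interval contains the distance `t` from `s`. -/
noncomputable def sphereIn (r : α → α → Prop) (y : α → ℕ) (V : Finset α) (s : α) (t : ℕ) :
    Finset α :=
  V.filter fun v => (¬ ∃ k ≤ t, WReach (fun a b => r a b ∧ a ∈ V ∧ b ∈ V) y s v k) ∧
    ∃ k ≤ t + y v, WReach (fun a b => r a b ∧ a ∈ V ∧ b ∈ V) y s v k

variable {r : α → α → Prop} {y : α → ℕ} {V : Finset α} {s : α} {t : ℕ}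

theorem mem_ballIn {v : α} : v ∈ ballIn r y V s t ↔
    v ∈ V ∧ ∃ k ≤ t, WReach (fun a b => r a b ∧ a ∈ V ∧ b ∈ V) y s v k := by
  classical
  exact Finset.mem_filter

theorem mem_sphereIn {v : α} : v ∈ sphereIn r y V s t ↔
    v ∈ V ∧ (¬ ∃ k ≤ t, WReach (fun a b => r a b ∧ a ∈ V ∧ b ∈ V) y s v k) ∧
      ∃ k ≤ t + y v, WReach (fun a b => r a b ∧ a ∈ V ∧ b ∈ V) y s v k := by
  classical
  exact Finset.mem_filter

theorem ballIn_subset : ballIn r y V s t ⊆ V := by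
  classical
  exact Finset.filter_subset _ _

theorem sphereIn_subset : sphereIn r y V s t ⊆ V := by
  classical
  exact Finset.filter_subset _ _

theorem disjoint_ballIn_sphereIn : Disjoint (ballIn r y V s t) (sphereIn r y V s t) := by
  rw [Finset.disjoint_left]
  intro v hv hv'
  exact (mem_sphereIn.1 hv').2.1 (mem_ballIn.1 hv).2

theorem mem_sphereIn_of_le {v : α} {k : ℕ} (hv : v ∈ V) (hk : k ≤ t + y v)
    (h : WReach (fun a b => r a b ∧ a ∈ V ∧ b ∈ V) y s v k) (hb : v ∉ ballIn r y V s t) :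
    v ∈ sphereIn r y V s t :=
  mem_sphereIn.2 ⟨hv, fun h' => hb (mem_ballIn.2 ⟨hv, h'⟩), k, hk, h⟩

theorem mem_sphereIn_of_adj {a b : α} (ha : a ∈ ballIn r y V s t) (hab : r a b) (hb : b ∈ V)
    (hb' : b ∉ ballIn r y V s t) : b ∈ sphereIn r y V s t := by
  obtain ⟨haV, k, hk, hw⟩ := mem_ballIn.1 ha
  exact mem_sphereIn_of_le hb (by omega) (hw.step ⟨hab, haV, hb⟩) hb'

theorem WReach.restrict_ballIn {v : α} {k : ℕ}
    (h : WReach (fun a b => r a b ∧ a ∈ V ∧ b ∈ V) y s v k) (hs : s ∈ V) (hk : k ≤ t) :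
    WReach (fun a b => r a b ∧ a ∈ ballIn r y V s t ∧ b ∈ ballIn r y V s t) y s v k ∧
      v ∈ ballIn r y V s t := by
  induction h with
  | refl => exact ⟨.refl, mem_ballIn.2 ⟨hs, _, hk, .refl⟩⟩
  | step h hab ih =>
    obtain ⟨h₁, h₂⟩ := ih (by omega)
    have h₃ : _ ∈ ballIn r y V s t := mem_ballIn.2 ⟨hab.2.2, _, hk, h.step hab⟩
    exact ⟨.step h₁ ⟨hab.1, h₂, h₃⟩, h₃⟩

theorem pow_mul_lt_of_growth {a : ℕ → ℝ} {q : ℝ} (hq : 0 ≤ q) {R : ℕ} (hR : 0 < R)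
    (h : ∀ t < R, q * a t < a (t + 1)) : q ^ R * a 0 < a R := by
  induction R, hR using Nat.le_induction with
  | base => simpa using h 0 (by norm_num)
  | succ n hn ih =>
    calc q ^ (n + 1) * a 0 = q * (q ^ n * a 0) := by ring
      _ ≤ q * a n := mul_le_mul_of_nonneg_left (ih fun t ht => h t (by omega)).le hq
      _ < _ := h n (by omega)

variable [DecidableEq α]

/-- A vertex at distance `d` lies only on spheres of level `i` with `d - y v ≤ i < d`. -/
theorem card_sphereIn_le (v : α) :
    ((Finset.range t).filter fun i => v ∈ sphereIn r y V s i).card ≤ y v := by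
  classical
  by_cases h : ∃ k, WReach (fun a b => r a b ∧ a ∈ V ∧ b ∈ V) y s v k
  · obtain ⟨d, hd, hmin⟩ := WReach.exists_min h
    calc _ ≤ (Finset.Ico (d - y v) d).card := by
          refine Finset.card_le_card fun i hi => ?_
          obtain ⟨-, h₁, k, hk, hw⟩ := mem_sphereIn.1 (Finset.mem_filter.1 hi).2
          have := hmin k hw
          rw [Finset.mem_Ico]
          refine ⟨by omega, ?_⟩
          by_contra hlt
          exact h₁ ⟨d, by omega, hd⟩
      _ ≤ y v := by rw [Nat.card_Ico]; omega
  · rw [Finset.filter_false_of_mem]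
    · simp
    · intro i _ hi
      obtain ⟨-, -, k, -, hw⟩ := mem_sphereIn.1 hi
      exact h ⟨k, hw⟩

/-- Double counting with `card_sphereIn_le`; a vertex on a sphere of level below `t` belongs to the
ball or the sphere of level `t`. -/
theorem sum_sphereIn_le {c : α → ℝ} (hc : ∀ v ∈ V, 0 ≤ c v) :
    ∑ i ∈ Finset.range t, ∑ v ∈ sphereIn r y V s i, c v ≤
      ∑ v ∈ ballIn r y V s t ∪ sphereIn r y V s t, c v * y v := by
  set S := ballIn r y V s t ∪ sphereIn r y V s t with hS
  have hSV : S ⊆ V := Finset.union_subset ballIn_subset sphereIn_subset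
  have hsub : ∀ i ∈ Finset.range t, sphereIn r y V s i = S.filter (· ∈ sphereIn r y V s i) := by
    intro i hi
    ext v
    rw [Finset.mem_filter]
    refine ⟨fun hv => ⟨?_, hv⟩, fun hv => hv.2⟩
    obtain ⟨hvV, -, k, hk, hw⟩ := mem_sphereIn.1 hv
    have := Finset.mem_range.1 hi
    by_cases hb : v ∈ ballIn r y V s t
    · exact Finset.mem_union_left _ hb
    · exact Finset.mem_union_right _ (mem_sphereIn_of_le hvV (by omega) hw hb)
  calc _ = ∑ i ∈ Finset.range t, ∑ v ∈ S, if v ∈ sphereIn r y V s i then c v else 0 := by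
        refine Finset.sum_congr rfl fun i hi => ?_
        rw [← Finset.sum_filter, ← hsub i hi]
    _ = ∑ v ∈ S, c v * ((Finset.range t).filter fun i => v ∈ sphereIn r y V s i).card := by
        rw [Finset.sum_comm]
        refine Finset.sum_congr rfl fun v _ => ?_
        rw [← Finset.sum_filter, Finset.sum_const, nsmul_eq_mul, mul_comm]
    _ ≤ _ := Finset.sum_le_sum fun v hv =>
        mul_le_mul_of_nonneg_left (by exact_mod_cast card_sphereIn_le v) (hc v (hSV hv))

/-- If all `R` spheres were expensive, then `ε` plus the accumulated sphere cost would grow by a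
factor above `1 + q` at each level, and would end above `ε` plus the total volume. The seed `ε`
keeps the bound meaningful where the volume near `s` is zero. -/
theorem exists_light_sphere {c : α → ℝ} (hc : ∀ v ∈ V, 0 ≤ c v) {R : ℕ} (hR : 0 < R) {q ε : ℝ}
    (hq : 0 ≤ q) (hε : ε + ∑ v ∈ V, c v * y v ≤ (1 + q) ^ R * ε) :
    ∃ t < R, ∑ v ∈ sphereIn r y V s t, c v ≤
      q * (ε + ∑ v ∈ ballIn r y V s t ∪ sphereIn r y V s t, c v * y v) := by
  by_contra! hcon
  have := pow_mul_lt_of_growth (R := R) (q := 1 + q)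
    (a := fun t => ε + ∑ i ∈ Finset.range t, ∑ v ∈ sphereIn r y V s i, c v) (by linarith) hR ?_
  · simp only [Finset.range_zero, Finset.sum_empty, add_zero] at this
    have h₁ := sum_sphereIn_le (r := r) (y := y) (s := s) (t := R) hc
    have h₂ : ∑ v ∈ ballIn r y V s R ∪ sphereIn r y V s R, c v * y v ≤ ∑ v ∈ V, c v * y v :=
      Finset.sum_le_sum_of_subset_of_nonneg (Finset.union_subset ballIn_subset sphereIn_subset)
        fun v hv _ => mul_nonneg (hc v hv) (Nat.cast_nonneg _)
    linarith
  · intro t ht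
    have h₁ := hcon t ht
    have h₂ := mul_le_mul_of_nonneg_left (sum_sphereIn_le (r := r) (y := y) (s := s) (t := t) hc) hq
    simp only [Finset.sum_range_succ]
    nlinarith

/-- Region growing: deleting a cheap vertex set leaves a graph in which any two connected vertices
are connected by a light walk. -/
theorem exists_cheap_separator (hr : ∀ a b, r a b → r b a) {c : α → ℝ} {R : ℕ} (hR : 0 < R)
    {q ε : ℝ} (hq : 0 ≤ q) (V : Finset α) (hc : ∀ v ∈ V, 0 ≤ c v)
    (hε : ε + ∑ v ∈ V, c v * y v ≤ (1 + q) ^ R * ε) (hε₀ : 0 ≤ ε) :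
    ∃ X ⊆ V, ∑ v ∈ X, c v ≤ q * (V.card * ε + ∑ v ∈ V, c v * y v) ∧
      ∀ u ∈ V \ X, ∀ v, Relation.ReflTransGen (fun a b => r a b ∧ a ∈ V \ X ∧ b ∈ V \ X) u v →
        ∃ k ≤ 2 * R, WReach (fun a b => r a b ∧ a ∈ V \ X ∧ b ∈ V \ X) y u v k := by
  induction V using Finset.strongInduction with
  | H V ih =>
  rcases V.eq_empty_or_nonempty with rfl | ⟨s, hs⟩
  · exact ⟨∅, by simp, by simp, by simp⟩
  obtain ⟨t, htR, ht⟩ := exists_light_sphere (r := r) (s := s) hc hR hq hε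
  set I := ballIn r y V s t with hI
  set B := sphereIn r y V s t with hB
  have hIV : I ⊆ V := ballIn_subset
  have hBV : B ⊆ V := sphereIn_subset
  have hIB : ∀ v ∈ I, v ∉ B := fun _ hv =>
    Finset.disjoint_left.1 disjoint_ballIn_sphereIn hv
  have hSV : I ∪ B ⊆ V := Finset.union_subset hIV hBV
  -- The centre itself lies on the sphere when `y s > t`. In either case it is removed, so the
  -- recursion terminates.
  have hsS : s ∈ I ∪ B := by
    by_cases h : s ∈ I
    · exact Finset.mem_union_left _ h
    · exact Finset.mem_union_right _ (mem_sphereIn_of_le hs (Nat.le_add_left _ _) .refl h)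
  have hss : V \ (I ∪ B) ⊂ V :=
    Finset.sdiff_ssubset hSV ⟨s, hsS⟩
  have hsplit := Finset.sum_sdiff (f := fun v => c v * (y v : ℝ)) hSV
  have hnn : 0 ≤ ∑ v ∈ I ∪ B, c v * (y v : ℝ) :=
    Finset.sum_nonneg fun v hv => mul_nonneg (hc v (hSV hv)) (Nat.cast_nonneg _)
  obtain ⟨X, hXV, hX, hconn⟩ := ih _ hss (fun v hv => hc v (hss.1 hv)) (by linarith)
  have hXS : ∀ v ∈ X, v ∉ I ∪ B := fun v hv => (Finset.mem_sdiff.1 (hXV hv)).2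
  refine ⟨B ∪ X, Finset.union_subset hBV (hXV.trans hss.1), ?_, ?_⟩
  · have hdisj : Disjoint B X := Finset.disjoint_left.2 fun v hv hv' =>
      hXS v hv' (Finset.mem_union_right _ hv)
    rw [Finset.sum_union hdisj]
    -- At least one vertex leaves in each round and pays for that round's `ε`.
    have hcard : ((V \ (I ∪ B)).card : ℝ) + 1 ≤ V.card := by
      exact_mod_cast Finset.card_lt_card hss
    have := mul_le_mul_of_nonneg_left (mul_le_mul_of_nonneg_right hcard hε₀) hq
    rw [← hsplit]
    linarith
  · have hIX : ∀ v ∈ I, v ∈ V \ (B ∪ X) := fun v hv => by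
      rw [Finset.mem_sdiff, Finset.mem_union, not_or]
      exact ⟨hIV hv, hIB v hv, fun h => hXS v h (Finset.mem_union_left _ hv)⟩
    intro u hu v huv
    -- The sphere `B` separates `I` from the rest. Inside `I`, walks through `s` have weight at most
    -- `2 * t`; outside, induction applies.
    by_cases huI : u ∈ I
    · have hvI : v ∈ I := by
        induction huv with
        | refl => exact huI
        | tail _ hab ih =>
          by_contra hb
          rw [Finset.mem_sdiff, Finset.mem_union, not_or] at hab
          exact (Finset.mem_sdiff.1 hab.2.2).2
            (Finset.mem_union_left _ (mem_sphereIn_of_adj ih hab.1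
              (Finset.mem_sdiff.1 hab.2.2).1 hb))
      have hreach : ∀ w ∈ I, ∃ k ≤ t,
          WReach (fun a b => r a b ∧ a ∈ V \ (B ∪ X) ∧ b ∈ V \ (B ∪ X)) y s w k := by
        intro w hw
        obtain ⟨-, k, hk, h⟩ := mem_ballIn.1 hw
        exact ⟨k, hk, (h.restrict_ballIn hs hk).1.mono
          fun a b hab => ⟨hab.1, hIX _ hab.2.1, hIX _ hab.2.2⟩⟩
      obtain ⟨k, hk, hw⟩ := hreach u huI
      obtain ⟨k', hk', hw'⟩ := hreach v hvI
      obtain ⟨l, hl, hwl⟩ := (hw.symm fun a b hab => ⟨hr _ _ hab.1, hab.2.2, hab.2.1⟩).trans hw'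
      exact ⟨l, by omega, hwl⟩
    · have hout : ∀ w ∈ V \ (B ∪ X), w ∉ I → w ∈ (V \ (I ∪ B)) \ X := by
        intro w hw hwI
        simp only [Finset.mem_sdiff, Finset.mem_union] at hw ⊢
        tauto
      have hout' : ∀ w ∈ (V \ (I ∪ B)) \ X, w ∈ V \ (B ∪ X) := by
        intro w hw
        simp only [Finset.mem_sdiff, Finset.mem_union] at hw ⊢
        tauto
      have hstep : Relation.ReflTransGen (fun a b => r a b ∧ a ∈ (V \ (I ∪ B)) \ X ∧
          b ∈ (V \ (I ∪ B)) \ X) u v ∧ v ∉ I := by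
        induction huv with
        | refl => exact ⟨.refl, huI⟩
        | @tail a b _ hab ih =>
          have hb : b ∉ I := by
            intro hb
            have haB := mem_sphereIn_of_adj hb (hr _ _ hab.1) (Finset.mem_sdiff.1 hab.2.1).1 ih.2
            exact (Finset.mem_sdiff.1 hab.2.1).2 (Finset.mem_union_left _ haB)
          exact ⟨ih.1.tail ⟨hab.1, hout _ hab.2.1 ih.2, hout _ hab.2.2 hb⟩, hb⟩
      obtain ⟨k, hk, hw⟩ := hconn u (hout u hu huI) v hstep.1
      exact ⟨k, hk, hw.mono fun a b hab => ⟨hab.1, hout' _ hab.2.1, hout' _ hab.2.2⟩⟩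

end RegionGrowing

/-! ### Rounding: the logarithmic upper bound -/

section UpperBound

variable {α β : Type*} {G : Graph α β} {c x : α → ℝ} {n : ℕ}

/-- With `n + 1` levels and a seed equal to a fraction `1 / n` of the volume, the growth needed is
exactly `n + 1`. The rate `q = exp (log (n + 1) / (n + 1)) - 1` achieves it and is of order `log n /
n`. -/
theorem exists_growth_rate (n : ℕ) : ∃ q : ℝ, 0 ≤ q ∧ (1 + q) ^ (n + 1) = n + 1 ∧
    q * (n + 1) ≤ 2 * Real.log (n + 1) := by
  have hn : (0 : ℝ) < n + 1 := by positivity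
  have hlog : 0 ≤ Real.log (n + 1) := Real.log_nonneg (by linarith [n.cast_nonneg (α := ℝ)])
  have hle : Real.log (n + 1) ≤ n + 1 := (Real.log_le_sub_one_of_pos hn).trans (by linarith)
  set a := Real.log (n + 1) / (n + 1) with ha
  have ha₀ : 0 ≤ a := by positivity
  have ha₁ : a ≤ 1 := (div_le_one hn).2 hle
  have han : a * (n + 1) = Real.log (n + 1) := div_mul_cancel₀ _ hn.ne'
  refine ⟨Real.exp a - 1, by linarith [Real.add_one_le_exp a], ?_, ?_⟩
  · rw [add_sub_cancel, ← Real.exp_nat_mul]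
    push_cast
    rw [mul_comm, han, Real.exp_log hn]
  · have h := Real.abs_exp_sub_one_le (x := a) (by rwa [abs_of_nonneg ha₀])
    rw [abs_of_nonneg ha₀] at h
    calc _ ≤ 2 * a * (n + 1) := mul_le_mul_of_nonneg_right ((le_abs_self _).trans h) hn.le
      _ = _ := by rw [mul_assoc, han]

theorem indicator_mem_diamondIPRegion [DecidableEq α] (hV : V(G).Finite) {X : Finset α}
    (hX : ∀ D ≤ G, D.IsDiamond → ∃ v ∈ V(D), v ∈ X) :
    (fun v => if v ∈ X then (1 : ℝ) else 0) ∈ G.diamondIPRegion := by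
  have h₀ : ∀ v, (0 : ℝ) ≤ if v ∈ X then (1 : ℝ) else 0 := fun v => by split_ifs <;> norm_num
  refine ⟨⟨fun v _ => h₀ v, fun D hD hDd => ?_⟩, fun v _ => ?_⟩
  · obtain ⟨v, hv, hvX⟩ := hX D hD hDd
    have hf : V(D).Finite := hV.subset hD.vertexSet_mono
    rw [finsum_mem_eq_finite_toFinset_sum _ hf]
    calc (1 : ℝ) = if v ∈ X then (1 : ℝ) else 0 := by rw [if_pos hvX]
      _ ≤ _ := Finset.single_le_sum (f := fun v => if v ∈ X then (1 : ℝ) else 0)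
        (fun i _ => h₀ i) (hf.mem_toFinset.2 hv)
  · simp only
    split_ifs
    · exact .inr rfl
    · exact .inl rfl

theorem diamondIPValue_le_of_hitting [DecidableEq α] (hV : V(G).Finite) {X : Finset α}
    (hXV : (X : Set α) ⊆ V(G)) (hX : ∀ D ≤ G, D.IsDiamond → ∃ v ∈ V(D), v ∈ X) :
    G.diamondIPValue c ≤ ENNReal.ofReal (∑ v ∈ X, c v) := by
  refine (iInf₂_le _ (indicator_mem_diamondIPRegion hV hX)).trans_eq ?_
  rw [finsum_mem_eq_finite_toFinset_sum _ hV]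
  congr 1
  simp only [mul_ite, mul_one, mul_zero]
  rw [← Finset.sum_filter]
  congr 1
  ext v
  simp only [Finset.mem_filter, Set.Finite.mem_toFinset]
  exact ⟨fun h => h.2, fun h => ⟨hXV h, h⟩⟩

/-- Rounding of a fractional diamond hitting set. -/
theorem exists_hitting_le_log [DecidableEq α] [DecidableEq β] (hV : V(G).Finite)
    (hE : E(G).Finite) (hn : hV.toFinset.card = n) (hc : ∀ v ∈ V(G), 0 ≤ c v)
    (hx : x ∈ G.diamondLPRegion) :
    ∃ X : Finset α, (X : Set α) ⊆ V(G) ∧ (∀ D ≤ G, D.IsDiamond → ∃ v ∈ V(D), v ∈ X) ∧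
      ∑ v ∈ X, c v ≤ 80 * Real.log (n + 1) * ∑ v ∈ hV.toFinset, c v * x v := by
  obtain ⟨q, hq, hqn, hqlog⟩ := exists_growth_rate n
  set V := hV.toFinset with hVdef
  have hmem : ∀ v, v ∈ V ↔ v ∈ V(G) := fun v => hV.mem_toFinset
  -- A light diamond has rounded weight at most `6 * 2 * (n + 1)`, and rounding down loses at most
  -- `n` more. The scale `20 * (n + 1)` exceeds this sum.
  set N : ℝ := 20 * (n + 1) with hN
  have hN₀ : 0 < N := by positivity
  set y : α → ℕ := fun v => ⌊N * x v⌋₊ with hy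
  -- This seed makes the `n` possible rounds contribute just one more copy of the volume, whence `20
  -- * 2 * 2 = 80`.
  set ε : ℝ := (∑ v ∈ V, c v * y v) / n with hε
  have hcy : 0 ≤ ∑ v ∈ V, c v * y v := Finset.sum_nonneg fun v hv =>
    mul_nonneg (hc v ((hmem v).1 hv)) (Nat.cast_nonneg _)
  have hε₀ : 0 ≤ ε := by positivity
  have hnε : n * ε = ∑ v ∈ V, c v * y v := by
    rcases Nat.eq_zero_or_pos n with h | h
    · have : V = ∅ := by rw [← Finset.card_eq_zero, hn, h]
      rw [h, this]; simp
    · have : (n : ℝ) ≠ 0 := by positivity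
      rw [hε]; field_simp
  obtain ⟨X, hXV, hX, hconn⟩ := exists_cheap_separator (r := G.Adj) (y := y) (c := c)
    (R := n + 1) (q := q) (ε := ε) (fun _ _ h => h.symm) (Nat.succ_pos n) hq V
    (fun v hv => hc v ((hmem v).1 hv)) (by rw [hqn, ← hnε]; linarith) hε₀
  refine ⟨X, fun v hv => (hmem v).1 (hXV hv), ?_, ?_⟩
  · intro D hD hDd
    by_contra! hcon
    set H := G.induce ((V \ X : Finset α) : Set α) with hH
    have hHG : H ≤ G := induce_le fun v hv =>
      (hmem v).1 (Finset.mem_sdiff.1 hv).1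
    have hDH : D ≤ H := by
      refine ⟨fun v hv => ?_, fun e a b h => ⟨h.mono hD, ?_, ?_⟩⟩
      · exact Finset.mem_sdiff.2 ⟨(hmem v).2 (hD.vertexSet_mono hv), hcon v hv⟩
      · exact Finset.mem_sdiff.2 ⟨(hmem a).2 (h.mono hD).left_mem, hcon a h.left_mem⟩
      · exact Finset.mem_sdiff.2 ⟨(hmem b).2 (h.mono hD).right_mem, hcon b h.right_mem⟩
    obtain ⟨D', W, hD'H, hD', hW, hsum⟩ := hDd.exists_light hDH
      (hE.subset hHG.edgeSet_mono) (y := y) (m := 2 * (n + 1)) (by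
        intro u hu v huv
        obtain ⟨k, hk, hw⟩ := hconn u hu v (Relation.ReflTransGen.mono
          (fun a b ⟨e, he⟩ => ⟨⟨e, he.1⟩, he.2.1, he.2.2⟩) _ _ huv)
        exact ⟨k, hk, hw.mono fun a b ⟨⟨e, he⟩, ha, hb⟩ => ⟨e, he, ha, hb⟩⟩)
    have hD'G := hD'H.trans hHG
    have hf : V(D').Finite := hV.subset hD'G.vertexSet_mono
    have h₁ := hx.2 D' hD'G hD'
    rw [finsum_mem_eq_finite_toFinset_sum _ hf] at h₁
    have hsub : hf.toFinset ⊆ V := fun v hv =>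
      (hmem v).2 (hD'G.vertexSet_mono (hf.mem_toFinset.1 hv))
    have h₂ : ∑ v ∈ hf.toFinset, y v ≤ 6 * (2 * (n + 1)) :=
      (Finset.sum_le_sum_of_subset fun v hv => hW (hf.mem_toFinset.1 hv)).trans hsum
    have h₃ : N * ∑ v ∈ hf.toFinset, x v ≤ ∑ v ∈ hf.toFinset, ((y v : ℝ) + 1) := by
      rw [Finset.mul_sum]
      exact Finset.sum_le_sum fun v _ => (Nat.lt_floor_add_one _).le
    have h₄ : (hf.toFinset.card : ℝ) ≤ n := by
      rw [← hn]; exact_mod_cast Finset.card_le_card hsub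
    have h₅ : ((∑ v ∈ hf.toFinset, y v : ℕ) : ℝ) ≤ 6 * (2 * (n + 1)) := by exact_mod_cast h₂
    rw [Finset.sum_add_distrib, Finset.sum_const, nsmul_eq_mul, mul_one] at h₃
    push_cast at h₅
    have h₆ : N * 1 ≤ N * ∑ v ∈ hf.toFinset, x v := mul_le_mul_of_nonneg_left h₁ hN₀.le
    linarith [n.cast_nonneg (α := ℝ)]
  · have h₁ : ∑ v ∈ V, c v * y v ≤ N * ∑ v ∈ V, c v * x v := by
      rw [Finset.mul_sum]
      refine Finset.sum_le_sum fun v hv => ?_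
      have hv' := (hmem v).1 hv
      calc c v * y v ≤ c v * (N * x v) := mul_le_mul_of_nonneg_left
            (Nat.floor_le (mul_nonneg hN₀.le (hx.1 v hv'))) (hc v hv')
        _ = _ := by ring
    have hcx : 0 ≤ ∑ v ∈ V, c v * x v := Finset.sum_nonneg fun v hv =>
      mul_nonneg (hc v ((hmem v).1 hv)) (hx.1 v ((hmem v).1 hv))
    rw [hn, hnε] at hX
    calc _ ≤ _ := hX
      _ ≤ q * (N * ∑ v ∈ V, c v * x v + N * ∑ v ∈ V, c v * x v) := by gcongr
      _ = q * (n + 1) * (40 * ∑ v ∈ V, c v * x v) := by rw [hN]; ring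
      _ ≤ 2 * Real.log (n + 1) * (40 * ∑ v ∈ V, c v * x v) := by gcongr
      _ = _ := by ring

theorem diamondIPValue_le (hn : V(G).encard = n) (hE : E(G).Finite) (hc : ∀ v ∈ V(G), 0 ≤ c v) :
    G.diamondIPValue c ≤ ENNReal.ofReal (80 * Real.log (n + 1)) * G.diamondLPValue c := by
  classical
  have hV : V(G).Finite := Set.finite_of_encard_eq_coe hn
  have hn' : hV.toFinset.card = n := by
    rw [hV.encard_eq_coe_toFinset_card] at hn
    exact_mod_cast hn
  have hlog : 0 ≤ 80 * Real.log (n + 1) :=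
    mul_nonneg (by norm_num) (Real.log_nonneg (by linarith [n.cast_nonneg (α := ℝ)]))
  -- The factor `log (n + 1)` is zero for `n = 0`, so moving it inside the infimum needs a feasible
  -- point; the all-one vector is one.
  have : Nonempty G.diamondLPRegion := by
    refine ⟨⟨_, (indicator_mem_diamondIPRegion hV (X := hV.toFinset) fun D hD hDd => ?_).1⟩⟩
    obtain ⟨u, v, W, F, -, hP, -⟩ := hDd.exists_pathOn
    have hu := (hP 0).mem_vertexSet (hP 0).left_mem
    exact ⟨u, hu, hV.mem_toFinset.2 (hD.vertexSet_mono hu)⟩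
  rw [diamondLPValue, iInf_subtype', ENNReal.mul_iInf fun h => absurd h ENNReal.ofReal_ne_top]
  refine le_iInf fun ⟨x, hx⟩ => ?_
  obtain ⟨X, hXV, hX, hle⟩ := exists_hitting_le_log hV hE hn' hc hx
  rw [← ENNReal.ofReal_mul hlog, finsum_mem_eq_finite_toFinset_sum _ hV]
  exact (diamondIPValue_le_of_hitting hV hXV hX).trans (ENNReal.ofReal_le_ofReal hle)

theorem diamondIntegralityGap_le (n : ℕ) :
    diamondIntegralityGap n ≤ ENNReal.ofReal (80 * Real.log (n + 1)) := by
  refine sSup_le ?_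
  rintro _ ⟨α, β, G, c, hn, hE, -, hc, rfl⟩
  exact ENNReal.div_le_of_le_mul (diamondIPValue_le hn hE hc)

end UpperBound

/-! ### Structure of diamonds and of diamond-free graphs -/

section LowerBound

variable {α β : Type*} [DecidableEq α] [DecidableEq β] {G : Graph α β}

theorem PathOn.edgeConn_erase {u v a b : α} {e : β} {W : Finset α} {F : Finset β}
    (h : G.PathOn u v W F) (he : e ∈ F) (hl : G.IsLink e a b) :
    (G.EdgeConn (F.erase e) u a ∧ G.EdgeConn (F.erase e) b v) ∨
      (G.EdgeConn (F.erase e) u b ∧ G.EdgeConn (F.erase e) a v) := by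
  induction h with
  | nil => simp at he
  | @cons f u w v W F hf hP hu ih =>
    have hfF : f ∉ F := fun h => hu (hP.mem_of_isLink h hf)
    rcases Finset.mem_insert.1 he with rfl | he
    · rw [Finset.erase_insert hfF]
      rcases hl.eq_and_eq_or_eq_and_eq hf with ⟨rfl, rfl⟩ | ⟨rfl, rfl⟩
      · exact .inl ⟨.rfl, hP.edgeConn⟩
      · exact .inr ⟨.rfl, hP.edgeConn⟩
    · have hfe : f ≠ e := fun h => hfF (h ▸ he)
      have hsub : F.erase e ⊆ (insert f F).erase e :=
        Finset.erase_subset_erase _ (Finset.subset_insert _ _)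
      have hfs : G.EdgeConn ((insert f F).erase e) u w :=
        .of_isLink (Finset.mem_erase.2 ⟨hfe, Finset.mem_insert_self _ _⟩) hf
      rcases ih he with ⟨h₁, h₂⟩ | ⟨h₁, h₂⟩
      · exact .inl ⟨hfs.trans (h₁.mono hsub), h₂.mono hsub⟩
      · exact .inr ⟨hfs.trans (h₁.mono hsub), h₂.mono hsub⟩

/-- The ends of an edge of a diamond remain connected after the deletion of this edge. -/
theorem IsDiamond.edgeConn_of_isLink {D : Graph α β} (hD : D.IsDiamond) {e : β} {a b : α}
    (hl : D.IsLink e a b) : ∃ F : Finset β, e ∉ F ∧ D.EdgeConn F a b := by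
  obtain ⟨u, v, W, F, huv, hP, hdisj, hE⟩ := hD.exists_pathOn
  obtain ⟨i, hi⟩ := Set.mem_iUnion.1 (hE ▸ hl.edge_mem)
  obtain ⟨j, hij⟩ : ∃ j : Fin 3, i ≠ j := ⟨i + 1, by clear hi; revert i; decide⟩
  -- The detour runs back along the path of the deleted edge to one end of the diamond, across
  -- another path `j`, and back to the other end of the edge.
  have huv' : D.EdgeConn ((F i).erase e ∪ F j) u v :=
    (hP j).edgeConn.mono Finset.subset_union_right
  refine ⟨(F i).erase e ∪ F j, ?_, ?_⟩
  · rw [Finset.mem_union, not_or]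
    exact ⟨Finset.notMem_erase _ _, Finset.disjoint_left.1 (hdisj i j hij) hi⟩
  · rcases (hP i).edgeConn_erase hi hl with ⟨h₁, h₂⟩ | ⟨h₁, h₂⟩
    · exact ((h₁.mono Finset.subset_union_left).symm.trans huv').trans
        (h₂.mono Finset.subset_union_left).symm
    · exact (h₂.mono Finset.subset_union_left).trans
        (huv'.symm.trans (h₁.mono Finset.subset_union_left))

/-- A vertex with three neighbours on a path avoiding it belongs to a common diamond. -/
theorem PathOn.exists_isDiamond {u w v : α} {W : Finset α} {F : Finset β} (hP : G.PathOn w v W F)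
    (hu : u ∉ W) {x : Fin 3 → α} {e : Fin 3 → β} (hx : Function.Injective x)
    (hxW : ∀ i, x i ∈ W) (hl : ∀ i, G.IsLink (e i) u (x i)) : ∃ D ≤ G, D.IsDiamond := by
  have hw : ∀ i, G.EdgeConn F w (x i) := by
    intro i
    obtain ⟨_, _, F₁, F₂, h₁, -, -, rfl, -⟩ := hP.split (hxW i)
    exact h₁.edgeConn.mono Finset.subset_union_left
  -- The legs of a tripod on the path, extended by the three edges to `u`, are edge-disjoint
  -- connections between `m` and `u`.
  obtain ⟨m, A, B, C, hA, hB, hC, hAB, hAC, hBC, cA, cB, cC⟩ :=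
    EdgeConn.exists_tripod (hl 0).right_mem ((hw 1).symm.trans (hw 0)) ((hw 2).symm.trans (hw 0))
  have hm : m ∈ (W : Set α) := (cA.mono hA).symm.mem_of_mem
    (fun f hf a b hab => hP.mem_of_isLink hf hab) (hxW 0)
  have hmu : m ≠ u := fun h => hu (h ▸ hm)
  have heF : ∀ i, e i ∉ F := fun i h => hu (hP.mem_of_isLink h (hl i))
  have he : Function.Injective e := by
    intro i j hij
    have := hl i
    rw [hij] at this
    exact hx (this.right_unique (hl j))
  have conn : ∀ i {A : Finset β}, G.EdgeConn A m (x i) → G.EdgeConn (insert (e i) A) m u :=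
    fun i A h => (h.mono (Finset.subset_insert _ _)).trans
      (.of_isLink (Finset.mem_insert_self _ _) (hl i).symm)
  have disj : ∀ i j {A B : Finset β}, i ≠ j → A ⊆ F → B ⊆ F → Disjoint A B →
      Disjoint (insert (e i) A) (insert (e j) B) := by
    intro i j A B hij hA hB hAB
    simp only [Finset.disjoint_insert_left, Finset.disjoint_insert_right, Finset.mem_insert,
      not_or]
    exact ⟨⟨he.ne hij.symm, fun h => heF j (hA h)⟩, fun h => heF i (hB h), hAB⟩
  exact exists_isDiamond_of_edgeConn hmu (disj 0 1 (by decide) hA hB hAB)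
    (disj 0 2 (by decide) hA hC hAC) (disj 1 2 (by decide) hB hC hBC) (conn 0 cA) (conn 1 cB)
    (conn 2 cC)

/-- A diamond-free graph has a vertex with at most two neighbours. -/
theorem exists_card_neighbors_le_two [G.Loopless] {U : Finset α} (hU : V(G) = U)
    (hne : U.Nonempty) (hG : ∀ D ≤ G, ¬ D.IsDiamond) :
    ∃ v ∈ U, ∀ N : Finset α, (∀ w ∈ N, G.Adj v w) → N.card ≤ 2 := by
  have hbdd : ∀ k, (∃ u v W F, G.PathOn u v W F ∧ W.card = k) → k ≤ U.card := by
    rintro k ⟨u, v, W, F, hP, rfl⟩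
    refine Finset.card_le_card fun a ha => ?_
    have := hP.mem_vertexSet ha
    rwa [hU] at this
  obtain ⟨z, hz⟩ := hne
  have hex : ∃ k, ∃ u v W F, G.PathOn u v W F ∧ W.card = k :=
    ⟨_, z, z, _, _, .nil (by rw [hU]; exact hz), rfl⟩
  classical
  -- Take a longest path. All neighbours of its end `u` lie on it, and three of them would yield a
  -- diamond.
  obtain ⟨u, v, W, F, hP, hW⟩ := Nat.findGreatest_spec (P := fun k => ∃ u v W F,
    G.PathOn u v W F ∧ W.card = k) (hbdd _ hex.choose_spec) hex.choose_spec
  have hmax : ∀ u' v' W' F', G.PathOn u' v' W' F' → W'.card ≤ W.card := by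
    intro u' v' W' F' h
    rw [hW]
    exact Nat.le_findGreatest (hbdd _ ⟨_, _, _, _, h, rfl⟩) ⟨_, _, _, _, h, rfl⟩
  have huU := hP.mem_vertexSet hP.left_mem
  rw [hU] at huU
  refine ⟨u, huU, fun N hN => ?_⟩
  by_contra! hcard
  have hNW : ∀ w ∈ N, w ∈ W := by
    intro w hw
    by_contra hwW
    obtain ⟨e, he⟩ := hN w hw
    have := hmax _ _ _ _ (PathOn.cons he.symm hP hwW)
    rw [Finset.card_insert_of_notMem hwW] at this
    omega
  obtain ⟨N', hN', hN'3⟩ := Finset.exists_subset_card_eq hcard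
  let x : Fin 3 → α := fun i => (N'.equivFinOfCardEq hN'3).symm i
  have hx : Function.Injective x :=
    Subtype.val_injective.comp (N'.equivFinOfCardEq hN'3).symm.injective
  have hxN : ∀ i, x i ∈ N := fun i => hN' ((N'.equivFinOfCardEq hN'3).symm i).2
  choose e he using fun i => hN (x i) (hxN i)
  have hne : ∀ i, x i ≠ u := fun i => (he i).ne.symm
  cases hP with
  | nil => exact hne 0 (Finset.mem_singleton.1 (hNW _ (hxN 0)))
  | cons hl hP hu =>
    obtain ⟨D, hD, hDd⟩ := hP.exists_isDiamond hu hx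
      (fun i => (Finset.mem_insert.1 (hNW _ (hxN i))).resolve_left (hne i)) he
    exact hG D hD hDd

end LowerBound

/-! ### Sparse graphs without small diamonds: the logarithmic lower bound -/

section LargeDiamonds

variable {α : Type*} [Fintype α] {S : SimpleGraph α} {g d : ℕ}

open Classical in
/-- The neighbours of a vertex of a finite simple graph. -/
noncomputable def nbrs (S : SimpleGraph α) (v : α) : Finset α :=
  Finset.univ.filter (S.Adj v)

theorem mem_nbrs {v w : α} : w ∈ nbrs S v ↔ S.Adj v w := by
  classical
  exact Finset.mem_filter.trans (by simp)

theorem mem_nbrs_comm {v w : α} : w ∈ nbrs S v ↔ v ∈ nbrs S w := by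
  rw [mem_nbrs, mem_nbrs, S.adj_comm]

instance loopless_ofSimpleGraph {α : Type*} (S : SimpleGraph α) : (ofSimpleGraph S).Loopless := by
  rw [loopless_iff_forall_ne_of_adj]
  intro u v h
  exact ((ofSimpleGraph_adj_iff u v).1 h).ne

theorem sum_card_inter_comm [DecidableEq α] (S : SimpleGraph α) (A B : Finset α) :
    ∑ w ∈ A, (nbrs S w ∩ B).card = ∑ w ∈ B, (nbrs S w ∩ A).card := by
  have h : ∀ (w : α) (B : Finset α), (nbrs S w ∩ B).card =
      ∑ v ∈ B, if v ∈ nbrs S w then 1 else 0 := by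
    intro w B
    rw [← Finset.card_filter, Finset.inter_comm, Finset.filter_mem_eq_inter]
  simp only [h]
  rw [Finset.sum_comm]
  simp only [mem_nbrs_comm]

/-- A diamond-free induced subgraph of a simple graph is sparse. -/
theorem sum_card_nbrs_inter_le [DecidableEq α] (U : Finset α)
    (hU : ∀ D ≤ (ofSimpleGraph S).induce (U : Set α), ¬ D.IsDiamond) :
    ∑ w ∈ U, (nbrs S w ∩ U).card ≤ 4 * U.card := by
  induction U using Finset.strongInduction with
  | H U ih =>
  rcases U.eq_empty_or_nonempty with rfl | hne
  · simp
  have hle : (ofSimpleGraph S).induce (U : Set α) ≤ ofSimpleGraph S := induce_le (by simp)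
  have := Loopless.anti hle
  obtain ⟨v, hv, hN⟩ := exists_card_neighbors_le_two (G := (ofSimpleGraph S).induce (U : Set α))
    rfl hne hU
  have hv2 : (nbrs S v ∩ U).card ≤ 2 := hN _ fun w hw => by
    rw [Finset.mem_inter, mem_nbrs] at hw
    exact ⟨s(v, w), ⟨rfl, hw.1⟩, hv, hw.2⟩
  -- Deleting `v` destroys at most two edges, each counted twice in the degree sum, hence the
  -- constant 4.
  have hih := ih (U.erase v) (Finset.erase_ssubset hv) fun D hD => hU D
    (hD.trans ⟨by simp, fun e x y h =>
      ⟨h.1, Finset.mem_of_mem_erase h.2.1, Finset.mem_of_mem_erase h.2.2⟩⟩)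
  have hcard := Finset.card_erase_add_one hv
  have hsplit : ∀ w, (nbrs S w ∩ U).card ≤
      (nbrs S w ∩ U.erase v).card + (nbrs S w ∩ {v}).card := by
    intro w
    refine (Finset.card_le_card ?_).trans (Finset.card_union_le _ _)
    intro x hx
    by_cases hxv : x = v <;> simp_all
  have h₁ : ∑ w ∈ U.erase v, (nbrs S w ∩ {v}).card ≤ 2 := by
    rw [sum_card_inter_comm, Finset.sum_singleton]
    exact (Finset.card_le_card (Finset.inter_subset_inter_left (Finset.erase_subset _ _))).trans hv2
  have h₂ : ∑ w ∈ U.erase v, (nbrs S w ∩ U).card ≤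
      ∑ w ∈ U.erase v, (nbrs S w ∩ U.erase v).card + 2 := by
    refine (Finset.sum_le_sum fun w _ => hsplit w).trans ?_
    rw [Finset.sum_add_distrib]
    omega
  rw [← Finset.sum_erase_add _ _ hv]
  omega

/-- In a simple graph in which at least half of the vertices have the maximum degree 16, a diamond
hitting set contains a positive proportion of the vertices. -/
theorem card_le_of_hitting [DecidableEq α] (hdeg : ∀ v, (nbrs S v).card ≤ 16)
    (hdef : 2 * (Finset.univ.filter fun v => (nbrs S v).card < 16).card ≤ Fintype.card α)
    {X : Finset α} (hX : ∀ D ≤ ofSimpleGraph S, D.IsDiamond → ∃ v ∈ V(D), v ∈ X) :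
    Fintype.card α ≤ 7 * X.card := by
  have hU := sum_card_nbrs_inter_le (S := S) Xᶜ fun D hD hDd => by
    obtain ⟨v, hv, hvX⟩ := hX D (hD.trans (induce_le (by simp))) hDd
    have := hD.vertexSet_mono hv
    simp [hvX] at this
  have hcard := Finset.card_add_card_compl X
  have hsum : 8 * Fintype.card α ≤ ∑ v, (nbrs S v).card := by
    have h₁ := Finset.card_filter_add_card_filter_not (s := (Finset.univ : Finset α))
      (fun v => (nbrs S v).card < 16)
    rw [Finset.card_univ] at h₁
    calc 8 * Fintype.card α ≤
          (Finset.univ.filter fun v => ¬ (nbrs S v).card < 16).card * 16 := by omega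
      _ ≤ ∑ v ∈ Finset.univ.filter fun v => ¬ (nbrs S v).card < 16, (nbrs S v).card := by
          rw [← smul_eq_mul]
          refine Finset.card_nsmul_le_sum _ _ _ fun v hv => ?_
          exact not_lt.1 (Finset.mem_filter.1 hv).2
      _ ≤ _ := Finset.sum_le_sum_of_subset (Finset.filter_subset _ _)
  have hXsum : ∀ A : Finset α, ∑ v ∈ X, (nbrs S v ∩ A).card ≤ X.card * 16 := fun A => by
    rw [← smul_eq_mul]
    exact Finset.sum_le_card_nsmul _ _ _ fun v _ =>
      (Finset.card_le_card Finset.inter_subset_left).trans (hdeg v)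
  have hsplit : ∑ v, (nbrs S v).card = ∑ v ∈ Xᶜ, (nbrs S v ∩ Xᶜ).card +
      ∑ v ∈ Xᶜ, (nbrs S v ∩ X).card + ∑ v ∈ X, (nbrs S v ∩ Finset.univ).card := by
    rw [← Finset.sum_compl_add_sum X]
    simp only [Finset.inter_univ]
    rw [← Finset.sum_add_distrib]
    congr 1
    refine Finset.sum_congr rfl fun v _ => ?_
    rw [← Finset.sdiff_eq_inter_compl, Finset.card_sdiff_add_card_inter]
  rw [sum_card_inter_comm S Xᶜ X] at hsplit
  -- With `n` vertices in all: `8 n ≤ 4 (n - |X|) + 16 |X| + 16 |X|`, that is, `4 n ≤ 28 |X|`.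
  have h₁ := hXsum Xᶜ
  have h₂ := hXsum Finset.univ
  omega

/-- The vertices at distance at most `k` from `v`. -/
noncomputable def ballAround [DecidableEq α] (S : SimpleGraph α) (v : α) : ℕ → Finset α
  | 0 => {v}
  | k + 1 => ballAround S v k ∪ (ballAround S v k).biUnion (nbrs S)

theorem card_ballAround_le [DecidableEq α] (hdeg : ∀ v, (nbrs S v).card ≤ d) (v : α) (k : ℕ) :
    (ballAround S v k).card ≤ (d + 1) ^ k := by
  induction k with
  | zero => simp [ballAround]
  | succ k ih =>
    have h₁ := Finset.card_biUnion_le_card_mul (ballAround S v k) (nbrs S) d fun w _ => hdeg w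
    have h₂ := Finset.card_union_le (ballAround S v k) ((ballAround S v k).biUnion (nbrs S))
    calc (ballAround S v (k + 1)).card ≤ (ballAround S v k).card * (d + 1) := by
          rw [ballAround]; linarith
      _ ≤ (d + 1) ^ k * (d + 1) := Nat.mul_le_mul_right _ ih

theorem ballAround_mono [DecidableEq α] (S : SimpleGraph α) (v : α) : Monotone (ballAround S v) :=
  monotone_nat_of_le_succ fun _ => Finset.subset_union_left

theorem PathOn.mem_ballAround {β : Type*} [DecidableEq α] [DecidableEq β] {K : Graph α β}
    {u v : α} {W : Finset α} {F : Finset β} (h : K.PathOn u v W F)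
    (hF : ∀ f ∈ F, ∀ x y, K.IsLink f x y → S.Adj x y) {k : ℕ} (hk : W.card ≤ k + 1) :
    u ∈ ballAround S v k := by
  induction h generalizing k with
  | nil => exact ballAround_mono S _ (Nat.zero_le k) (Finset.mem_singleton_self _)
  | @cons e u w v W F hl hP hu ih =>
    have hW : 0 < W.card := Finset.card_pos.2 ⟨_, hP.left_mem⟩
    rw [Finset.card_insert_of_notMem hu] at hk
    obtain ⟨k, rfl⟩ : ∃ l, k = l + 1 := ⟨k - 1, by omega⟩
    refine Finset.mem_union_right _ (Finset.mem_biUnion.2 ⟨w, ih (fun f hf =>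
      hF f (Finset.mem_insert_of_mem hf)) (by omega), ?_⟩)
    exact mem_nbrs.2 (hF e (Finset.mem_insert_self _ _) _ _ hl).symm

theorem card_nbrs_sup_edge_le [DecidableEq α] {a b : α} (hdeg : ∀ v, (nbrs S v).card ≤ d)
    (ha : (nbrs S a).card < d) (hb : (nbrs S b).card < d) (v : α) :
    (nbrs (S ⊔ SimpleGraph.edge a b) v).card ≤ d := by
  have hmem : ∀ w ∈ nbrs (S ⊔ SimpleGraph.edge a b) v,
      w ∈ nbrs S v ∨ (v = a ∧ w = b ∨ v = b ∧ w = a) := by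
    intro w hw
    rw [mem_nbrs, SimpleGraph.sup_adj, SimpleGraph.edge_adj] at hw
    exact hw.imp mem_nbrs.2 And.left
  by_cases h : (nbrs S v).card < d
  · by_cases hva : v = a
    · refine (Finset.card_le_card (t := insert b (nbrs S v)) fun w hw => ?_).trans
        ((Finset.card_insert_le _ _).trans h)
      rw [Finset.mem_insert]
      rcases hmem w hw with h | ⟨-, rfl⟩ | ⟨hvb, hwa⟩
      · exact .inr h
      · exact .inl rfl
      · exact .inl (hwa.trans (hva.symm.trans hvb))
    · refine (Finset.card_le_card (t := insert a (nbrs S v)) fun w hw => ?_).trans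
        ((Finset.card_insert_le _ _).trans h)
      rw [Finset.mem_insert]
      rcases hmem w hw with h | ⟨h, -⟩ | ⟨-, rfl⟩
      · exact .inr h
      · exact absurd h hva
      · exact .inl rfl
  · refine (Finset.card_le_card (t := nbrs S v) fun w hw => ?_).trans (hdeg v)
    rcases hmem w hw with h' | ⟨rfl, -⟩ | ⟨rfl, -⟩
    · exact h'
    · exact absurd ha h
    · exact absurd hb h

/-- There is a graph of maximum degree at most `d` without small diamonds, in which few vertices
have degree less than `d`. -/
theorem exists_simpleGraph_large_diamonds [DecidableEq α] (d : ℕ) {g : ℕ} (hg : 0 < g) :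
    ∃ S : SimpleGraph α, (∀ v, (nbrs S v).card ≤ d) ∧
      (∀ D ≤ ofSimpleGraph S, D.IsDiamond → g ≤ V(D).ncard) ∧
      (Finset.univ.filter fun v => (nbrs S v).card < d).card ≤ (d + 1) ^ g := by
  have hbot : (⊥ : SimpleGraph α) ∈ {S : SimpleGraph α | (∀ v, (nbrs S v).card ≤ d) ∧
      ∀ D ≤ ofSimpleGraph S, D.IsDiamond → g ≤ V(D).ncard} := by
    refine ⟨fun v => ?_, fun D hD hDd => ?_⟩
    · rw [Finset.card_eq_zero.2]
      · exact Nat.zero_le _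
      · exact Finset.eq_empty_of_forall_notMem fun w hw => (mem_nbrs.1 hw).elim
    · exfalso
      obtain ⟨u, v, W, F, huv, hP, -⟩ := hDd.exists_pathOn
      obtain ⟨e, -, a, -, b, -, hl, -⟩ := (hP 0).edgeConn.exists_isLink_of_mem_of_notMem
        (Set.mem_singleton u) (fun h => huv h.symm)
      simpa using (hl.mono hD).adj
  -- By maximality, joining two nonadjacent vertices of deficient degree must create a small
  -- diamond.
  obtain ⟨S, -, hS⟩ := (Set.toFinite _).exists_le_maximal hbot
  refine ⟨S, hS.1.1, hS.1.2, ?_⟩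
  rcases (Finset.univ.filter fun v => (nbrs S v).card < d).eq_empty_or_nonempty with h | ⟨b, hb⟩
  · rw [h]; simp
  -- All deficient vertices lie within distance `g` of one of them, `b`, and such a ball is small
  -- because degrees are bounded.
  refine (Finset.card_le_card fun a ha => ?_).trans (card_ballAround_le hS.1.1 b g)
  rw [Finset.mem_filter] at ha hb
  by_cases hab : a = b
  · subst hab
    exact ballAround_mono S _ (Nat.zero_le g) (Finset.mem_singleton_self _)
  by_cases hadj : S.Adj a b
  · refine ballAround_mono S _ hg (Finset.mem_union_right _ (Finset.mem_biUnion.2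
      ⟨b, Finset.mem_singleton_self _, mem_nbrs.2 hadj.symm⟩))
  have hlt : S < S ⊔ SimpleGraph.edge a b := SimpleGraph.lt_sup_edge S a b hab hadj
  have hnot := hS.not_prop_of_gt hlt
  have hD : ∃ D ≤ ofSimpleGraph (S ⊔ SimpleGraph.edge a b), D.IsDiamond ∧ V(D).ncard < g := by
    by_contra! hcon
    exact hnot ⟨card_nbrs_sup_edge_le hS.1.1 ha.2 hb.2, hcon⟩
  obtain ⟨D, hD, hDd, hcard⟩ := hD
  have hlink : ∀ {e x y}, D.IsLink e x y → e ≠ s(a, b) → e = s(x, y) ∧ S.Adj x y := by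
    intro e x y hl he
    obtain ⟨rfl, h⟩ := hl.mono hD
    rw [SimpleGraph.mem_edgeSet, SimpleGraph.sup_adj, SimpleGraph.edge_adj] at h
    refine ⟨rfl, h.resolve_right fun h => he ?_⟩
    rcases h.1 with ⟨rfl, rfl⟩ | ⟨rfl, rfl⟩
    · rfl
    · exact Sym2.eq_swap
  by_cases hDab : s(a, b) ∈ E(D)
  · have hl : D.IsLink s(a, b) a b := (hD.isLink_iff hDab).2 ⟨rfl, by
      rw [SimpleGraph.mem_edgeSet, SimpleGraph.sup_adj, SimpleGraph.edge_adj]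
      exact .inr ⟨.inl ⟨rfl, rfl⟩, hab⟩⟩
    -- A small diamond through the new edge `ab` still connects `a` to `b` without it, by a path of
    -- `S` with fewer than `g` vertices.
    obtain ⟨F, hF, hconn⟩ := hDd.edgeConn_of_isLink hl
    obtain ⟨W, F', hF', hP⟩ := PathOn.exists_of_edgeConn hconn hl.right_mem
    refine hP.mem_ballAround (fun f hf x y hxy => (hlink hxy fun h => hF (h ▸ hF' hf)).2) ?_
    have : W.card ≤ V(D).ncard := by
      rw [← Set.ncard_coe_finset]
      exact Set.ncard_le_ncard (fun x hx => hP.mem_vertexSet hx) (Set.toFinite _)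
    omega
  · have hDS : D ≤ ofSimpleGraph S := by
      refine ⟨by simp, fun e x y hl => ?_⟩
      obtain ⟨rfl, h⟩ := hlink hl fun h => hDab (h ▸ hl.edge_mem)
      exact ⟨rfl, h⟩
    exact absurd (hS.1.2 D hDS hDd) (not_le.2 hcard)

/-- Lower bound on the integrality gap from graphs without small diamonds. -/
theorem le_diamondIntegralityGap {n g : ℕ} (hg : 0 < g) (hgn : 2 * 17 ^ g ≤ n) :
    ENNReal.ofReal (g / 7) ≤ diamondIntegralityGap n := by
  -- At most `17 ^ g ≤ n / 2` vertices have degree below 16, as `card_le_of_hitting` requires.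
  obtain ⟨S, hdeg, hlarge, hdef⟩ := exists_simpleGraph_large_diamonds (α := Fin n) 16 hg
  norm_num at hdef
  have hg' : (0 : ℝ) < g := by exact_mod_cast hg
  have hn : (0 : ℝ) < n := by
    have : 0 < n := lt_of_lt_of_le (by positivity) hgn
    exact_mod_cast this
  set G := ofSimpleGraph S with hG
  have hV : V(G) = Set.univ := rfl
  have hVf : V(G).Finite := Set.toFinite _
  have hLP : G.diamondLPValue (fun _ => 1) ≤ ENNReal.ofReal (n / g) := by
    have hfeas : (fun _ => 1 / g : Fin n → ℝ) ∈ G.diamondLPRegion := by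
      refine ⟨fun v _ => by positivity, fun D hD hDd => ?_⟩
      rw [finsum_mem_eq_finite_toFinset_sum _ (Set.toFinite V(D)), Finset.sum_const, nsmul_eq_mul,
        ← Set.ncard_eq_toFinset_card, mul_one_div, one_le_div hg']
      exact_mod_cast hlarge D hD hDd
    refine (iInf₂_le _ hfeas).trans (ENNReal.ofReal_le_ofReal (le_of_eq ?_))
    rw [finsum_mem_eq_finite_toFinset_sum _ hVf]
    simp [hV, div_eq_mul_inv]
  have hIP : ENNReal.ofReal (n / 7) ≤ G.diamondIPValue (fun _ => 1) := by
    refine le_iInf₂ fun z hz => ENNReal.ofReal_le_ofReal ?_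
    rw [finsum_mem_eq_finite_toFinset_sum _ hVf]
    have hz01 : ∀ v, z v = 0 ∨ z v = 1 := fun v => hz.2 v (Set.mem_univ v)
    have hcard : Fintype.card (Fin n) ≤ 7 * (Finset.univ.filter fun v => z v = 1).card := by
      refine card_le_of_hitting hdeg ?_ fun D hD hDd => ?_
      · rw [Fintype.card_fin]
        omega
      · by_contra! hcon
        have h := hz.1.2 D hD hDd
        rw [finsum_mem_eq_finite_toFinset_sum _ (Set.toFinite _), Finset.sum_eq_zero] at h
        · linarith
        · intro v hv
          refine (hz01 v).resolve_right fun h1 => hcon v ?_ ?_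
          · simpa using hv
          · simpa using h1
    have hsum : ∑ v ∈ hVf.toFinset, 1 * z v = (Finset.univ.filter fun v => z v = 1).card := by
      rw [Finset.card_filter]
      push_cast
      refine Finset.sum_congr (by ext; simp [hV]) fun v _ => ?_
      rcases hz01 v with h | h <;> simp [h]
    rw [hsum, div_le_iff₀ (by norm_num)]
    rw [Fintype.card_fin] at hcard
    rw [mul_comm]
    exact_mod_cast hcard
  calc ENNReal.ofReal (g / 7) = ENNReal.ofReal (n / 7) / ENNReal.ofReal (n / g) := by
        rw [← ENNReal.ofReal_div_of_pos (by positivity)]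
        congr 1
        field_simp
    _ ≤ G.diamondIPValue (fun _ => 1) / G.diamondLPValue (fun _ => 1) := ENNReal.div_le_div hIP hLP
    _ ≤ _ := by
        refine le_sSup ?_
        exact ⟨Fin n, Sym2 (Fin n), G, fun _ => 1, by simp [hV], Set.toFinite _,
          loopless_ofSimpleGraph S, fun _ _ => zero_le_one, rfl⟩

/-- The factor 2 is absorbed by one more power of 17, and `log 17 ≤ 3`; then `3 * (g + 2) ≤ 9 * g`
because `g ≥ 1`. -/
theorem log_le_mul_of_lt {n g : ℕ} (hn : 0 < n) (hg : 0 < g) (h : n < 2 * 17 ^ (g + 1)) :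
    Real.log n ≤ 9 * g := by
  have h17 : Real.log 17 ≤ 3 := by
    rw [Real.log_le_iff_le_exp (by norm_num)]
    have h1 := Real.exp_one_gt_d9
    have h3 : Real.exp 3 = Real.exp 1 ^ 3 := by rw [← Real.exp_nat_mul]; norm_num
    rw [h3]
    calc (17 : ℝ) ≤ 2.7 ^ 3 := by norm_num
      _ ≤ _ := by gcongr; linarith
  have hle : (n : ℝ) ≤ 17 ^ (g + 2) := by
    have : n ≤ 17 ^ (g + 2) := by
      rw [pow_succ 17 (g + 1)]; omega
    exact_mod_cast this
  have hg' : (1 : ℝ) ≤ g := by exact_mod_cast hg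
  calc Real.log n ≤ Real.log (17 ^ (g + 2)) := Real.log_le_log (by exact_mod_cast hn) hle
    _ = (g + 2) * Real.log 17 := by rw [Real.log_pow]; push_cast; ring
    _ ≤ (g + 2) * 3 := by gcongr
    _ ≤ 9 * g := by linarith

end LargeDiamonds

end Graph

/-! ### Assembling both bounds -/

theorem mainTheorem4 :
    (∀ n : ℕ, Graph.diamondIntegralityGap n ≠ ⊤) ∧
      (fun n : ℕ => (Graph.diamondIntegralityGap n).toReal) =Θ[Filter.atTop]
        (fun n : ℕ => Real.log n) := by
  have htop : ∀ n : ℕ, Graph.diamondIntegralityGap n ≠ ⊤ := fun n =>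
    ne_top_of_le_ne_top ENNReal.ofReal_ne_top (Graph.diamondIntegralityGap_le n)
  refine ⟨htop, ?_, ?_⟩
  -- `160 = 80 * 2`, from `log (n + 1) ≤ 2 * log n` for `n ≥ 2`.
  · refine Asymptotics.IsBigO.of_bound 160 ?_
    filter_upwards [Filter.eventually_ge_atTop 2] with n hn
    have hn' : (2 : ℝ) ≤ n := by exact_mod_cast hn
    have hlog : Real.log (n + 1) ≤ 2 * Real.log n := by
      rw [← Real.log_rpow (by linarith), Real.rpow_two]
      exact Real.log_le_log (by linarith) (by nlinarith)
    have h := ENNReal.toReal_mono ENNReal.ofReal_ne_top (Graph.diamondIntegralityGap_le n)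
    rw [ENNReal.toReal_ofReal (mul_nonneg (by norm_num) (Real.log_nonneg (by linarith)))] at h
    rw [Real.norm_of_nonneg ENNReal.toReal_nonneg,
      Real.norm_of_nonneg (Real.log_nonneg (by linarith))]
    linarith
  -- `63 = 7 * 9`. The choice `g = Nat.log 17 (n / 2)` is the largest with `2 * 17 ^ g ≤ n`, and `n
  -- ≥ 34` makes it positive.
  · refine Asymptotics.IsBigO.of_bound 63 ?_
    filter_upwards [Filter.eventually_ge_atTop 34] with n hn
    have hg : 0 < Nat.log 17 (n / 2) := Nat.log_pos (by norm_num) (by omega)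
    have h₁ : 17 ^ Nat.log 17 (n / 2) ≤ n / 2 := Nat.pow_log_le_self 17 (by omega)
    have h₂ : n / 2 < 17 ^ (Nat.log 17 (n / 2) + 1) := Nat.lt_pow_succ_log_self (by norm_num) _
    have h := ENNReal.toReal_mono (htop n)
      (Graph.le_diamondIntegralityGap hg (by omega : 2 * 17 ^ Nat.log 17 (n / 2) ≤ n))
    rw [ENNReal.toReal_ofReal (by positivity)] at h
    have hlog := Graph.log_le_mul_of_lt (by omega) hg
      (by omega : n < 2 * 17 ^ (Nat.log 17 (n / 2) + 1))
    have hn' : (1 : ℝ) ≤ n := by exact_mod_cast (by omega : 1 ≤ n)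
    rw [Real.norm_of_nonneg ENNReal.toReal_nonneg, Real.norm_of_nonneg (Real.log_nonneg hn')]
    linarith
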